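/- All tournaments are finite and have at least one vertex. A tournament \(T\) contains a tournament \(S\) if \(S\) is isomorphic to a subtournament of \(T\), and \(T\) is \(\mathcal H\)-free if it contains no member of the set \(\mathcal H\). A set of vertices is transitive if it induces no directed cycle; the chromatic number \(\chi(T)\) is the least \(k\) such that \(V(T)\) can be coloured with \(k\) colours so that every colour class is transitive. A class of tournaments is hereditary if it contains every tournament that is contained in one of its members; the closure of a class is the smallest hereditary class including it. Let \(I\) be the one-vertex tournament and, for an integer \(k\ge 1\), let \(L_k\) be the transitive tournament with \(k\) vertices. Write \(H_1\Rightarrow H_2\) for the tournament obtained from the disjoint union of \(H_1\) and \(H_2\) by adding all edges from \(V(H_1)\) to \(V(H_2)\). For \(n\ge 2\) and tournaments \(T_1,\dots,T_{2n-1}\), let \(\Delta(T_1,\dots,T_{2n-1})\) be the tournament obtained from their disjoint union by adding, for all \(i<j\), all edges from \(V(T_j)\) to \(V(T_i)\) if \(i\) and \(j\) are both odd, and all edges from \(V(T_i)\) to \(V(T_j)\) otherwise. Let \(D_1=I\) and \(D_n=\Delta(I,D_{n-1},D_{n-1})\) for \(n\ge 2\), and let \(\mathcal D\) be the closure of \(\{D_n: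 n\ge 1\}\). For a tournament \(D\), a tournament \(H\) is a \(D\)-hero if there is a constant \(c\) such that every \(\{D,H\}\)-free tournament has chromatic number at most \(c\). **Theorem.** Let \(D\in\mathcal D\) be a tournament that contains \(D_3\). If a tournament \(H\) is a \(D\)-hero, then \(H\) is isomorphic to one of the following: 1. \(I\); 2. \(H_1\Rightarrow H_2\) for some \(D\)-heroes \(H_1\) and \(H_2\); 3. \(\Delta(I,L_k,H')\) or \(\Delta(I,H',L_k)\) for some integer \(k\ge 1\) and some \(D\)-hero \(H'\); 4. \(\Delta(L_{k_1},I,L_{k_2},L_{k_3},I)\) or \(\Delta(I,L_{k_1},L_{k_2},I,L_{k_3})\) for some integers \(k_1,k_2,k_3\ge 1\); 5. \(\Delta(I,H',L_{k_1},L_{k_2},I)\) or \(\Delta(I,L_{k_1},L_{k_2},H',I)\) for some integers \(k_1,k_2\ge 1\) and some \(D\)-hero \(H'\); 6. \(\Delta(I,L_{k_1},L_{k_2},I,L_{k_3},L_{k_4},I)\) for some integers \(k_1,k_2,k_3,k_4\ge 1\). -/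

import Mathlib

/-- A (finite, nonempty) tournament: a loopless digraph in which every two distinct vertices are
joined by exactly one of the two possible edges. `T.Adj u v` means that `uv` is an edge. -/
structure Tournament where
  V : Type
  finite : Finite V
  nonempty : Nonempty V
  Adj : V → V → Prop
  irrefl : ∀ v, ¬ Adj v v
  asymm : ∀ u v, Adj u v → ¬ Adj v u
  total : ∀ u v, u ≠ v → Adj u v ∨ Adj v u

namespace Tournament

/-- Isomorphism of tournaments. -/
def IsIso (T S : Tournament) : Prop := Nonempty (T.Adj ≃r S.Adj)

/-- `T` contains `S`: `S` is isomorphic to a subtournament of `T`. -/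
def Contains (T S : Tournament) : Prop := Nonempty (S.Adj ↪r T.Adj)

/-- `T` is `𝓗`-free: it contains no member of `𝓗`. -/
def IsFree (𝓗 : Set Tournament) (T : Tournament) : Prop := ∀ H ∈ 𝓗, ¬ T.Contains H

/-- A set `S` of vertices is transitive if the subtournament induced on `S` has no directed cycle,
that is, no closed directed walk of positive length. -/
def IsTransitiveSet (T : Tournament) (S : Set T.V) : Prop :=
  ∀ v : S, ¬ Relation.TransGen (fun a b : S => T.Adj a b) v v

/-- `T` has a `k`-coloring: a map to a `k`-element set all of whose fibres are transitive. -/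
def Colorable (T : Tournament) (k : ℕ) : Prop :=
  ∃ φ : T.V → Fin k, ∀ c, T.IsTransitiveSet (φ ⁻¹' {c})

/-- The chromatic number of a tournament. -/
noncomputable def chromaticNumber (T : Tournament) : ℕ := sInf {k | T.Colorable k}

/-- A sanity check: the set in the definition of the chromatic number is never empty. -/
theorem colorable_chromaticNumber (T : Tournament) : T.Colorable T.chromaticNumber := by
  have : ({k | T.Colorable k} : Set ℕ).Nonempty := by
    have := T.finite
    obtain ⟨n, ⟨e⟩⟩ := Finite.exists_equiv_fin T.V
    refine ⟨n, e, fun c v h => ?_⟩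
    have key : ∀ a b : (e ⁻¹' {c} : Set T.V), ¬ T.Adj a b := by
      rintro ⟨a, ha⟩ ⟨b, hb⟩
      have hab : a = b := e.injective ((ha : e a = c).trans (hb : e b = c).symm)
      subst hab
      exact T.irrefl a
    cases h with
    | single h => exact key _ _ h
    | tail _ h => exact key _ _ h
  exact Nat.sInf_mem this

/-- A set of tournaments is heroic if the tournaments free of it have bounded chromatic number. -/
def IsHeroic (𝓗 : Set Tournament) : Prop :=
  ∃ c : ℕ, ∀ T : Tournament, IsFree 𝓗 T → T.chromaticNumber ≤ c

/-- `H` is an `F`-hero. -/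
def IsHeroFor (F H : Tournament) : Prop := IsHeroic {F, H}

/-- A class of tournaments (invariant under isomorphism) is hereditary if it contains all
subtournaments of its members. -/
def IsHereditary (𝓣 : Set Tournament) : Prop :=
  ∀ T ∈ 𝓣, ∀ S : Tournament, T.Contains S → S ∈ 𝓣

/-- The closure of `𝓣`: the smallest hereditary class of tournaments containing `𝓣`. -/
def hereditaryClosure (𝓣 : Set Tournament) : Set Tournament :=
  ⋂₀ {𝓒 | IsHereditary 𝓒 ∧ 𝓣 ⊆ 𝓒}

/-- The transitive tournament `L_k` with `k ≥ 1` vertices. -/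
def L (k : ℕ+) : Tournament where
  V := Fin k
  finite := inferInstance
  nonempty := ⟨⟨0, k.pos⟩⟩
  Adj i j := i < j
  irrefl := lt_irrefl
  asymm _ _ := lt_asymm
  total _ _ := lt_or_gt_of_ne

/-- The one-vertex tournament `I`. -/
def I : Tournament where
  V := Unit
  finite := inferInstance
  nonempty := inferInstance
  Adj _ _ := False
  irrefl _ := id
  asymm _ _ := False.elim
  total _ _ h := (h rfl).elim

/-- `H₁ ⇒ H₂`: the disjoint union of `H₁` and `H₂` with all edges from `H₁` to `H₂` added. -/
def arrow (H₁ H₂ : Tournament) : Tournament where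
  V := H₁.V ⊕ H₂.V
  finite := by
    have := H₁.finite
    have := H₂.finite
    infer_instance
  nonempty := by
    have := H₁.nonempty
    infer_instance
  Adj := Sum.Lex H₁.Adj H₂.Adj
  irrefl := by
    rintro (a | a) h
    · exact H₁.irrefl a (Sum.lex_inl_inl.1 h)
    · exact H₂.irrefl a (Sum.lex_inr_inr.1 h)
  asymm := by
    rintro (a | a) (b | b) h h'
    · exact H₁.asymm a b (Sum.lex_inl_inl.1 h) (Sum.lex_inl_inl.1 h')
    · exact Sum.lex_inr_inl h'
    · exact Sum.lex_inr_inl h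
    · exact H₂.asymm a b (Sum.lex_inr_inr.1 h) (Sum.lex_inr_inr.1 h')
  total := by
    rintro (a | a) (b | b) h
    · simpa using H₁.total a b (fun e => h (congrArg _ e))
    · exact Or.inl (Sum.Lex.sep a b)
    · exact Or.inr (Sum.Lex.sep b a)
    · simpa using H₂.total a b (fun e => h (congrArg _ e))

/-- The edges of `Δ(T₁, …, T_{2n+1})`. The parts are indexed from `0` here, so the parts with an
odd number in the usual indexing from `1` are those whose index `i : Fin (2 * n + 1)` is even. -/
inductive DeltaAdj {n : ℕ} (T : Fin (2 * n + 1) → Tournament) :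
    (Σ i, (T i).V) → (Σ i, (T i).V) → Prop
  | within (i : Fin (2 * n + 1)) (x y : (T i).V) (h : (T i).Adj x y) : DeltaAdj T ⟨i, x⟩ ⟨i, y⟩
  | forward (i j : Fin (2 * n + 1)) (x : (T i).V) (y : (T j).V) (hij : i < j)
      (h : ¬ (Even i.val ∧ Even j.val)) : DeltaAdj T ⟨i, x⟩ ⟨j, y⟩
  | backward (i j : Fin (2 * n + 1)) (x : (T i).V) (y : (T j).V) (hij : i < j)
      (h : Even i.val ∧ Even j.val) : DeltaAdj T ⟨j, y⟩ ⟨i, x⟩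

/-- The tournament `Δ(T₁, T₂, …, T_{2n+1})`: the disjoint union of the `Tᵢ`, where for `i < j`
all edges go from `T_j` to `T_i` if `i` and `j` are both odd (indexing from `1`), and from `T_i`
to `T_j` otherwise. -/
def delta {n : ℕ} (T : Fin (2 * n + 1) → Tournament) : Tournament where
  V := Σ i, (T i).V
  finite := by
    have := fun i => (T i).finite
    infer_instance
  nonempty := ⟨⟨0, (T 0).nonempty.some⟩⟩
  Adj := DeltaAdj T
  irrefl := by
    rintro ⟨i, x⟩ h
    cases h with
    | within _ _ _ h => exact (T i).irrefl x h
    | forward _ _ _ _ hij _ => exact lt_irrefl _ hij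
    | backward _ _ _ _ hij _ => exact lt_irrefl _ hij
  asymm := by
    rintro ⟨i, x⟩ ⟨j, y⟩ h h'
    cases h with
    | within _ _ _ h =>
      cases h' with
      | within _ _ _ h' => exact (T i).asymm _ _ h h'
      | forward _ _ _ _ hij _ => exact lt_irrefl _ hij
      | backward _ _ _ _ hij _ => exact lt_irrefl _ hij
    | forward _ _ _ _ hij h =>
      cases h' with
      | within _ _ _ h' => exact lt_irrefl _ hij
      | forward _ _ _ _ hji _ => exact lt_asymm hij hji
      | backward _ _ _ _ _ h' => exact h h'
    | backward _ _ _ _ hij h =>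
      cases h' with
      | within _ _ _ h' => exact lt_irrefl _ hij
      | forward _ _ _ _ _ h' => exact h' h
      | backward _ _ _ _ hji _ => exact lt_asymm hij hji
  total := by
    rintro ⟨i, x⟩ ⟨j, y⟩ h
    rcases lt_trichotomy i j with hij | rfl | hij
    · by_cases hp : Even i.val ∧ Even j.val
      · exact Or.inr (.backward i j x y hij hp)
      · exact Or.inl (.forward i j x y hij hp)
    · rcases (T i).total x y (fun e => h (congrArg _ e)) with h | h
      · exact Or.inl (.within i x y h)
      · exact Or.inr (.within i y x h)
    · by_cases hp : Even j.val ∧ Even i.val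
      · exact Or.inl (.backward j i y x hij hp)
      · exact Or.inr (.forward j i y x hij hp)

/-- `Δ(A, B, C)`. -/
abbrev delta3 (A B C : Tournament) : Tournament := delta (n := 1) ![A, B, C]

/-- `Δ(A, B, C, D, E)`. -/
abbrev delta5 (A B C D E : Tournament) : Tournament := delta (n := 2) ![A, B, C, D, E]

/-- `Δ(A, B, C, D, E, F, G)`. -/
abbrev delta7 (A B C D E F G : Tournament) : Tournament := delta (n := 3) ![A, B, C, D, E, F, G]

/-- The tournaments `D_n` for `n ≥ 1`: `D_1 = I` and `D_n = Δ(I, D_{n-1}, D_{n-1})` for `n ≥ 2`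
(the value at `0` is irrelevant). -/
def D : ℕ → Tournament
  | 0 => I
  | 1 => I
  | n + 2 => delta3 I (D (n + 1)) (D (n + 1))

/-- The class `𝒟`: the closure of `{D_n | n ≥ 1}`. -/
def classD : Set Tournament := hereditaryClosure {T | ∃ n, 1 ≤ n ∧ T = D n}

end Tournament

namespace Tournament

/-! Two families of unbounded chromatic number, `layers` and `descartesTower`, both avoid `D 3`,
hence avoid every tournament containing it. A hero `H` is therefore contained in a member of each
family (`IsHeroFor.exists_contains`). The first family dictates the shape of `H`; the second trims
that shape to the listed cases.

Inside an iterated layering, `H` is a single vertex or its vertices sit at integer positions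
(`exists_layout`): even positions hold one vertex each and point backwards among themselves, and all
other edges between different positions go forward. If `H` is not strongly connected, it is `H₁ ⇒
H₂`. Otherwise the extreme positions are even, and `H` is Δ(E₀, O₁, E₂, …, E₂ᵣ), where the Eᵢ and Oᵢ
are the maximal runs of even and of odd positions, and every Eᵢ is transitive.

For a pattern with a Hamiltonian cycle, a finite check (`DescartesFree`) shows that no copy of it in
`descartes X N` meets the initial transitive set. The cycle then confines it to one copy of `X`, so
by induction it never occurs in `descartesTower`. With C₃ the cyclic triangle, the check succeeds
for D₃, Δ(L₂,L₂,L₂), Δ(I,C₃,I,C₃,I), Δ(L₂,I,I,C₃,I) and Δ(I,C₃,I,I,L₂). Excluding the last four from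
`H` settles everything: the first bounds the number of runs and forces many of them to be single
vertices, and the others force odd runs to be transitive. The parts H' that remain are heroes
because heroes pass to subtournaments (`IsHeroFor.mono`). -/

theorem Contains.trans {T S R : Tournament} (h : T.Contains S) (h' : S.Contains R) :
    T.Contains R :=
  h.elim fun f => h'.elim fun g => ⟨g.trans f⟩

theorem IsHeroFor.mono {F H H' : Tournament} (hH : IsHeroFor F H) (h : H.Contains H') :
    IsHeroFor F H' := by
  obtain ⟨c, hc⟩ := hH
  refine ⟨c, fun T hT => hc T ?_⟩
  rintro S (rfl | rfl) hS
  · exact hT _ (by simp) hS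
  · exact hT H' (by simp) (hS.trans h)

/-! ### Colourings, and families of unbounded chromatic number. -/

theorem Colorable.mono {T : Tournament} {k l : ℕ} (hkl : k ≤ l) (h : T.Colorable k) :
    T.Colorable l := by
  obtain ⟨φ, hφ⟩ := h
  refine ⟨fun v => Fin.castLE hkl (φ v), fun c v hv => ?_⟩
  refine hφ (φ v) ⟨v, rfl⟩ ?_
  have key : ∀ w : ((fun v => Fin.castLE hkl (φ v)) ⁻¹' {c} : Set T.V), φ w = φ v := fun w =>
    Fin.castLE_injective hkl
      ((show Fin.castLE hkl (φ w) = c from w.2).trans (show Fin.castLE hkl (φ v) = c from v.2).symm)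
  exact Relation.TransGen.lift (r := fun a b : ((fun v => Fin.castLE hkl (φ v)) ⁻¹' {c} : Set T.V) =>
    T.Adj a b) (fun w => (⟨w, key w⟩ : (φ ⁻¹' {φ v} : Set T.V))) (fun _ _ h => h) _ _ hv

/-- A hero is contained in some member of every family of tournaments with unbounded chromatic
number that avoids a subtournament of the fixed tournament. -/
theorem IsHeroFor.exists_contains {F H S : Tournament} (hH : IsHeroFor F H) (hS : F.Contains S)
    {U : ℕ → Tournament} (hU : ∀ k, ¬ (U k).Colorable k) (hfree : ∀ k, ¬ (U k).Contains S) :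
    ∃ k, (U k).Contains H := by
  obtain ⟨c, hc⟩ := hH
  by_contra! h
  refine hU c ((colorable_chromaticNumber _).mono (hc _ ?_))
  rintro R (rfl | rfl) hR
  · exact hfree c (hR.trans hS)
  · exact h c hR

theorem IsTransitiveSet.not_triangle {T : Tournament} {s : Set T.V} (hs : T.IsTransitiveSet s)
    {a b c : T.V} (ha : a ∈ s) (hb : b ∈ s) (hc : c ∈ s) (hab : T.Adj a b) (hbc : T.Adj b c) :
    ¬ T.Adj c a := fun hca =>
  hs ⟨a, ha⟩ (((Relation.TransGen.single (r := fun a b : s => T.Adj a b) (b := ⟨b, hb⟩) hab).tail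
    (c := ⟨c, hc⟩) hbc).tail hca)

theorem IsTransitiveSet.preimage {T S : Tournament} {s : Set T.V} (hs : T.IsTransitiveSet s)
    {f : S.V → T.V} (hf : ∀ a b, S.Adj a b → T.Adj (f a) (f b)) : S.IsTransitiveSet (f ⁻¹' s) :=
  fun v hv => hs ⟨f v, v.2⟩ <|
    Relation.TransGen.lift (fun w : (f ⁻¹' s : Set S.V) => (⟨f w, w.2⟩ : s))
      (fun _ _ h => hf _ _ h) _ _ hv

/-- If a copy of `S` in a `(k + 1)`-coloured tournament misses a colour, then `S` is
`k`-colourable. -/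
theorem Colorable.of_missing_color {T S : Tournament} {k : ℕ} {φ : T.V → Fin (k + 1)}
    (hφ : ∀ c, T.IsTransitiveSet (φ ⁻¹' {c})) {f : S.V → T.V}
    (hf : ∀ a b, S.Adj a b → T.Adj (f a) (f b)) (c : Fin (k + 1)) (hc : ∀ x, φ (f x) ≠ c) :
    S.Colorable k := by
  choose ψ hψ using fun x => Fin.exists_succAbove_eq (hc x)
  refine ⟨ψ, fun d => ?_⟩
  have : ψ ⁻¹' {d} = f ⁻¹' (φ ⁻¹' {c.succAbove d}) := by
    ext x
    simp [← hψ]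
  rw [this]
  exact (hφ _).preimage hf

theorem not_colorable_zero (T : Tournament) : ¬ T.Colorable 0 := fun ⟨φ, _⟩ =>
  (φ T.nonempty.some).elim0

theorem Adj.ne {T : Tournament} {a b : T.V} (h : T.Adj a b) : a ≠ b := by
  rintro rfl
  exact T.irrefl _ h

/-! ### Two constructions that raise the chromatic number. -/

/-- A transitive sequence of `m + 1` spine vertices, each of which is followed by a copy of `X`: spine vertices point backwards to each other, and all other edges go forward. -/
def layered (X : Tournament) (m : ℕ) : Tournament where
  V := Option X.V × Fin (m + 1)
  finite := by
    have := X.finite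
    infer_instance
  nonempty := ⟨none, 0⟩
  Adj
    | (none, i), (none, j) => j < i
    | (none, i), (some _, j) => i ≤ j
    | (some _, i), (none, j) => i < j
    | (some x, i), (some y, j) => i < j ∨ i = j ∧ X.Adj x y
  irrefl := by
    rintro ⟨_ | x, i⟩ <;> simp [X.irrefl]
  asymm := by
    rintro ⟨_ | x, i⟩ ⟨_ | y, j⟩ h h'
    · exact lt_asymm h h'
    · exact not_lt_of_ge h h'
    · exact not_lt_of_ge h' h
    · rcases h with h | ⟨rfl, h⟩ <;> rcases h' with h' | ⟨e, h'⟩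
      · exact lt_asymm h h'
      · exact h.ne' e
      · exact lt_irrefl _ h'
      · exact X.asymm _ _ h h'
  total := by
    rintro ⟨_ | x, i⟩ ⟨_ | y, j⟩ h
    · exact (lt_or_gt_of_ne (fun e => h (by rw [e]))).symm
    · exact le_or_gt i j
    · exact lt_or_ge i j
    · rcases lt_trichotomy i j with hij | rfl | hij
      · exact Or.inl (Or.inl hij)
      · rcases X.total x y (fun e => h (by rw [e])) with h | h
        · exact Or.inl (Or.inr ⟨rfl, h⟩)
        · exact Or.inr (Or.inr ⟨rfl, h⟩)
      · exact Or.inr (Or.inl hij)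

/-- There are more spine vertices than colours, so two of them share a colour. Each forms a cyclic
triangle with the other and any vertex of the copy of `X` that follows the earlier one, so this copy
misses their colour. -/
theorem layered_not_colorable {X : Tournament} {k m : ℕ} (hX : ¬ X.Colorable k) (hm : k < m) :
    ¬ (layered X m).Colorable (k + 1) := by
  rintro ⟨φ, hφ⟩
  obtain ⟨i, j, hij, hc⟩ : ∃ i j : Fin (m + 1), i < j ∧ φ (none, i) = φ (none, j) := by
    obtain ⟨i, j, hij, hc⟩ := Fintype.exists_ne_map_eq_of_card_lt
      (fun i : Fin (m + 1) => φ (none, i)) (by simpa using hm)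
    rcases lt_or_gt_of_ne hij with h | h
    · exact ⟨i, j, h, hc⟩
    · exact ⟨j, i, h, hc.symm⟩
  refine hX (Colorable.of_missing_color hφ (f := fun x => (some x, i)) ?_ (φ (none, i)) ?_)
  · exact fun a b h => Or.inr ⟨rfl, h⟩
  · intro x hx
    exact (hφ (φ (none, i))).not_triangle (a := (none, i)) (b := (some x, i)) (c := (none, j))
      rfl hx hc.symm (le_refl i) hij hij

/-- A transitive set of `N + 1` vertices, followed by one copy of `X` for each injection `e` of `X`
into it, in which `x` points back to `e x` and all other edges go forward. -/
noncomputable def descartes (X : Tournament) (N : ℕ) : Tournament where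
  V := Fin (N + 1) ⊕ (X.V ↪ Fin (N + 1)) × X.V
  finite := by
    have := X.finite
    infer_instance
  nonempty := ⟨.inl 0⟩
  Adj
    | .inl a, .inl b => a < b
    | .inl a, .inr (e, x) => e x ≠ a
    | .inr (e, x), .inl a => e x = a
    | .inr (e, x), .inr (f, y) =>
      have := X.finite
      Finite.equivFin _ e < Finite.equivFin _ f ∨ e = f ∧ X.Adj x y
  irrefl := by
    rintro (a | ⟨e, x⟩) <;> simp [X.irrefl]
  asymm := by
    rintro (a | ⟨e, x⟩) (b | ⟨f, y⟩) h h'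
    · exact lt_asymm h h'
    · exact h h'
    · exact h' h
    · rcases h with h | ⟨rfl, h⟩
      · rcases h' with h' | ⟨rfl, h'⟩
        · exact lt_asymm h h'
        · exact lt_irrefl _ h
      · rcases h' with h' | ⟨_, h'⟩
        · exact lt_irrefl _ h'
        · exact X.asymm _ _ h h'
  total := by
    rintro (a | ⟨e, x⟩) (b | ⟨f, y⟩) h
    · exact lt_or_gt_of_ne (fun e => h (by rw [e]))
    · exact ne_or_eq _ _
    · exact eq_or_ne _ _
    · have := X.finite
      rcases lt_trichotomy (Finite.equivFin _ e) (Finite.equivFin _ f) with hij | hij | hij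
      · exact Or.inl (Or.inl hij)
      · obtain rfl := (Finite.equivFin _).injective hij
        rcases X.total x y (fun e => h (by rw [e])) with h | h
        · exact Or.inl (Or.inr ⟨rfl, h⟩)
        · exact Or.inr (Or.inr ⟨rfl, h⟩)
      · exact Or.inr (Or.inl hij)

/-- A Descartes-type argument: some colour is so frequent on the transitive set that `X` injects
into that colour class without its last vertex. The copy of `X` indexed by this injection cannot use
the colour. -/
theorem descartes_not_colorable {X : Tournament} {k N : ℕ} (hX : ¬ X.Colorable k)
    (hN : (k + 1) * Nat.card X.V ≤ N) : ¬ (descartes X N).Colorable (k + 1) := by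
  classical
  rintro ⟨φ, hφ⟩
  have := X.finite
  obtain ⟨c, hc⟩ := Fintype.exists_lt_card_fiber_of_mul_lt_card
    (fun a : Fin (N + 1) => φ (.inl a)) (n := Nat.card X.V) (by simpa using Nat.lt_succ_of_le hN)
  set s : Finset (Fin (N + 1)) := {a | φ (.inl a) = c} with hs
  have hne : s.Nonempty := Finset.card_pos.1 (by omega)
  -- The largest vertex of the class is set aside: for each `x` it closes the cyclic triangle `e x`,
  -- maximum, `x`.
  have hcard : Nat.card X.V ≤ Nat.card (s.erase (s.max' hne) : Finset _) := by
    rw [Nat.card_eq_fintype_card (α := (s.erase (s.max' hne) : Finset _)), Fintype.card_coe, Finset.card_erase_of_mem (s.max'_mem hne)]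
    omega
  obtain ⟨g⟩ : Nonempty (X.V ↪ (s.erase (s.max' hne) : Finset _)) := by
    have := Fintype.ofFinite X.V
    rw [Nat.card_eq_fintype_card, Nat.card_eq_fintype_card] at hcard
    exact Function.Embedding.nonempty_of_card_le hcard
  let e : X.V ↪ Fin (N + 1) := g.trans (Function.Embedding.subtype _)
  have he : ∀ x, e x ∈ s.erase (s.max' hne) := fun x => (g x).2
  have hmem : ∀ a ∈ s, φ (.inl a) = c := fun a ha => by simpa [hs] using ha
  refine hX (Colorable.of_missing_color hφ (f := fun x => .inr (e, x)) ?_ c ?_)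
  · exact fun a b h => Or.inr ⟨rfl, h⟩
  · intro x hx
    have hlt : e x < s.max' hne := s.lt_max'_of_mem_erase_max' hne (he x)
    exact (hφ c).not_triangle (a := .inl (e x)) (b := .inl (s.max' hne)) (c := .inr (e, x))
      (hmem _ (Finset.mem_of_mem_erase (he x))) (hmem _ (s.max'_mem hne)) hx hlt hlt.ne rfl

/-- The tournaments obtained from `I` by iterating `layered`. -/
def layers : ℕ → Tournament
  | 0 => I
  | k + 1 => layered (layers k) (k + 1)

/-- The tournaments obtained from `I` by iterating `descartes`. -/
noncomputable def descartesTower : ℕ → Tournament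
  | 0 => I
  | k + 1 => descartes (descartesTower k) ((k + 1) * Nat.card (descartesTower k).V)

theorem layers_not_colorable : ∀ k, ¬ (layers k).Colorable k
  | 0 => not_colorable_zero _
  | k + 1 => layered_not_colorable (layers_not_colorable k) k.lt_succ_self

theorem descartesTower_not_colorable : ∀ k, ¬ (descartesTower k).Colorable k
  | 0 => not_colorable_zero _
  | k + 1 => descartes_not_colorable (descartesTower_not_colorable k) le_rfl

/-! ### Patterns that never occur in the Descartes tower. -/

/-- The arcs of the digraph on `{0, …, n - 1}` whose vertex `i` has the out-neighbours given by the
binary digits of the `i`-th entry of `O`. -/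
def maskAdj (O : List ℕ) (i j : ℕ) : Bool := (O.getD i 0).testBit j

/-- `T` contains all arcs of the digraph described by `O`. -/
def HasPattern (T : Tournament) (O : List ℕ) : Prop :=
  ∃ e : ℕ → T.V, ∀ i < O.length, ∀ j < O.length, maskAdj O i j = true → T.Adj (e i) (e j)

theorem HasPattern.of_contains {T S : Tournament} {O : List ℕ} (h : T.Contains S)
    (hS : S.HasPattern O) : T.HasPattern O := by
  obtain ⟨f⟩ := h
  obtain ⟨e, he⟩ := hS
  exact ⟨fun i => f (e i), fun i hi j hj h => f.map_rel_iff.2 (he i hi j hj h)⟩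

/-- A reason why a digraph cannot be mapped to `descartes X N` with exactly the vertices given by
the binary digits of `m` going to the initial transitive set. -/
def MaskObstruction (O : List ℕ) (m : ℕ) : Prop :=
  (∃ i < O.length, m.testBit i = true ∧ ∃ j < O.length, m.testBit j = true ∧ maskAdj O i j = true ∧
    ∃ k < O.length, m.testBit k = true ∧ maskAdj O j k = true ∧ maskAdj O k i = true) ∨
  (∃ i < O.length, m.testBit i = false ∧ ∃ j < O.length, m.testBit j = true ∧
    maskAdj O i j = true ∧ ∃ k < O.length, m.testBit k = true ∧ maskAdj O i k = true ∧
      maskAdj O j k = true) ∨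
  (∃ z < O.length, m.testBit z = true ∧ ∃ x < O.length, m.testBit x = false ∧
    maskAdj O x z = true ∧ ∃ y < O.length, m.testBit y = false ∧ maskAdj O y z = true ∧
      maskAdj O x y = true ∧ ∃ w < O.length, m.testBit w = false ∧ maskAdj O y w = true ∧
        ∃ u < O.length, m.testBit u = false ∧ (u = w ∨ maskAdj O w u = true) ∧
          maskAdj O u x = true)

instance (O : List ℕ) (m : ℕ) : Decidable (MaskObstruction O m) := by
  unfold MaskObstruction
  infer_instance

/-- A Hamiltonian cycle together with an obstruction for every nonempty set of vertices. -/
def DescartesFree (O : List ℕ) : Prop :=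
  0 < O.length ∧ (∀ i < O.length, maskAdj O i ((i + 1) % O.length) = true) ∧
    ∀ m < 2 ^ O.length, m ≠ 0 → MaskObstruction O m

instance (O : List ℕ) : Decidable (DescartesFree O) := by
  unfold DescartesFree
  infer_instance

/-- The three obstructions reflect three features of `descartes X N`: the initial set is transitive;
a vertex outside it has only one out-neighbour in it; and distinct vertices of the same copy have
different such out-neighbours, by injectivity. Hence the pattern avoids the initial set, and its
Hamiltonian cycle keeps it inside one copy of `X`. -/
theorem HasPattern.of_descartes {X : Tournament} {N : ℕ} {O : List ℕ} (hO : DescartesFree O)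
    (h : (descartes X N).HasPattern O) : X.HasPattern O := by
  obtain ⟨hpos, hcycle, hmask⟩ := hO
  obtain ⟨e, he⟩ := h
  have := X.finite
  -- The bits of `m` record which pattern vertices land in the initial transitive set.
  obtain ⟨m, hm, hbit⟩ : ∃ m < 2 ^ O.length, ∀ i < O.length, m.testBit i = (e i).isLeft :=
    ⟨Nat.ofBits fun i : Fin O.length => (e i).isLeft, Nat.ofBits_lt_two_pow _, fun i hi =>
      Nat.testBit_ofBits_lt _ i hi⟩
  have hl : ∀ i < O.length, m.testBit i = true → ∃ a, e i = .inl a := fun i hi h =>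
    Sum.isLeft_iff.1 ((hbit i hi).symm.trans h)
  have hr : ∀ i < O.length, m.testBit i = false → ∃ p, e i = .inr p := fun i hi h =>
    Sum.isRight_iff.1 (Sum.isLeft_eq_false.1 <| (hbit i hi).symm.trans h)
  have hle : ∀ {p q : (X.V ↪ Fin (N + 1)) × X.V}, (descartes X N).Adj (.inr p) (.inr q) →
      Finite.equivFin _ p.1 ≤ Finite.equivFin _ q.1 := by
    rintro ⟨f, x⟩ ⟨g, y⟩ (h | ⟨rfl, -⟩)
    exacts [h.le, le_rfl]
  by_cases h0 : m = 0
  · have hr' : ∀ i < O.length, ∃ p, e i = .inr p := fun i hi => hr i hi (by simp [h0])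
    have : Nonempty ((X.V ↪ Fin (N + 1)) × X.V) := (hr' 0 hpos).nonempty
    choose! p hp using hr'
    -- Edges outside the initial set never decrease the index of the copy, so this index is constant
    -- along the Hamiltonian cycle.
    have hstep : ∀ i, i + 1 < O.length →
        Finite.equivFin _ (p i).1 ≤ Finite.equivFin _ (p (i + 1)).1 := fun i hi => by
      have := he i (by omega) (i + 1) hi (by simpa [Nat.mod_eq_of_lt hi] using hcycle i (by omega))
      rw [hp i (by omega), hp (i + 1) hi] at this
      exact hle this
    have hmono : ∀ i j, i ≤ j → j < O.length →
        Finite.equivFin _ (p i).1 ≤ Finite.equivFin _ (p j).1 := fun i j hij => by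
      induction j, hij using Nat.le_induction with
      | base => exact fun _ => le_rfl
      | succ j _ ih => exact fun hj => (ih (by omega)).trans (hstep j hj)
    have hlast : Finite.equivFin _ (p (O.length - 1)).1 ≤ Finite.equivFin _ (p 0).1 := by
      have := he (O.length - 1) (by omega) 0 hpos
        (by simpa [Nat.sub_add_cancel hpos] using hcycle (O.length - 1) (by omega))
      rw [hp _ (by omega), hp 0 hpos] at this
      exact hle this
    have hconst : ∀ i < O.length, (p i).1 = (p 0).1 := fun i hi =>
      (Finite.equivFin _).injective <| le_antisymm
        ((hmono i (O.length - 1) (by omega) (by omega)).trans hlast) (hmono 0 i (by omega) hi)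
    refine ⟨fun i => (p i).2, fun i hi j hj h => ?_⟩
    have := he i hi j hj h
    rw [hp i hi, hp j hj] at this
    rcases this with h | ⟨-, h⟩
    · rw [hconst i hi, hconst j hj] at h
      exact absurd h (lt_irrefl _)
    · exact h
  · exfalso
    rcases hmask m hm h0 with ⟨i, hi, bi, j, hj, bj, hij, k, hk, bk, hjk, hki⟩ |
        ⟨i, hi, bi, j, hj, bj, hij, k, hk, bk, hik, hjk⟩ |
        ⟨z, hz, bz, x, hx, bx, hxz, y, hy, by', hyz, hxy, w, hw, bw, hyw, u, hu, bu, hwu, hux⟩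
    · obtain ⟨a, ha⟩ := hl i hi bi
      obtain ⟨b, hb⟩ := hl j hj bj
      obtain ⟨c, hc⟩ := hl k hk bk
      have h1 := he i hi j hj hij
      have h2 := he j hj k hk hjk
      have h3 := he k hk i hi hki
      rw [ha, hb] at h1
      rw [hb, hc] at h2
      rw [hc, ha] at h3
      exact lt_asymm (lt_trans (h1 : a < b) (h2 : b < c)) h3
    · obtain ⟨⟨f, a⟩, ha⟩ := hr i hi bi
      obtain ⟨b, hb⟩ := hl j hj bj
      obtain ⟨c, hc⟩ := hl k hk bk
      have h1 := he i hi j hj hij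
      have h2 := he i hi k hk hik
      have h3 := he j hj k hk hjk
      rw [ha, hb] at h1
      rw [ha, hc] at h2
      rw [hb, hc] at h3
      exact (lt_irrefl _ (((h1 : f a = b).symm.trans (h2 : f a = c)) ▸ (h3 : b < c)))
    · obtain ⟨c, hc⟩ := hl z hz bz
      obtain ⟨⟨f, a⟩, ha⟩ := hr x hx bx
      obtain ⟨⟨g, b⟩, hb⟩ := hr y hy by'
      obtain ⟨q, hq⟩ := hr w hw bw
      obtain ⟨r, hr⟩ := hr u hu bu
      have h1 := he x hx z hz hxz
      have h2 := he y hy z hz hyz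
      have h3 := he x hx y hy hxy
      have h4 := he y hy w hw hyw
      have h5 := he u hu x hx hux
      -- The closed walk x, y, w, (u,) x stays outside the initial set, so it stays in a single
      -- copy; there x and y would share their out-neighbour z.
      have h6 : Finite.equivFin _ q.1 ≤ Finite.equivFin _ r.1 := by
        rcases hwu with rfl | hwu
        · rw [hq] at hr
          rw [Sum.inr_injective hr]
        · have := he w hw u hu hwu
          rw [hq, hr] at this
          exact hle this
      rw [ha, hc] at h1
      rw [hb, hc] at h2
      rw [ha, hb] at h3
      rw [hb, hq] at h4
      rw [hr, ha] at h5
      have hfg : f = g := (Finite.equivFin _).injective <|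
        le_antisymm (hle h3) (((hle h4).trans h6).trans (hle h5))
      subst hfg
      obtain rfl : a = b := f.injective ((h1 : f a = c).trans (h2 : f b = c).symm)
      exact (descartes X N).irrefl _ h3

theorem DescartesFree.not_hasPattern_descartesTower {O : List ℕ} (hO : DescartesFree O) :
    ∀ k, ¬ (descartesTower k).HasPattern O
  | 0 => fun ⟨_, he⟩ => he 0 hO.1 _ (Nat.mod_lt _ hO.1) (hO.2.1 0 hO.1)
  | k + 1 => fun h => hO.not_hasPattern_descartesTower k (HasPattern.of_descartes hO h)

/-! ### Both families avoid D₃. -/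

/-- The arcs of `D_3`. -/
def arcsD3 : List ℕ := [14, 116, 120, 114, 33, 65, 17]

theorem descartesFree_arcsD3 : DescartesFree arcsD3 := by decide +kernel

theorem delta_adj_same {n : ℕ} {T : Fin (2 * n + 1) → Tournament} {i : Fin (2 * n + 1)}
    {x y : (T i).V} : (delta T).Adj ⟨i, x⟩ ⟨i, y⟩ ↔ (T i).Adj x y := by
  refine ⟨fun h => ?_, fun h => .within i x y h⟩
  cases h with
  | within _ _ _ h => exact h
  | forward _ _ _ _ h _ => exact absurd h (lt_irrefl _)
  | backward _ _ _ _ h _ => exact absurd h (lt_irrefl _)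

theorem delta_adj_of_lt {n : ℕ} {T : Fin (2 * n + 1) → Tournament} {u v : (delta T).V}
    (h : u.1 < v.1) : (delta T).Adj u v ↔ ¬ (Even u.1.val ∧ Even v.1.val) := by
  obtain ⟨i, x⟩ := u
  obtain ⟨j, y⟩ := v
  refine ⟨fun h' => ?_, fun h' => .forward i j x y h h'⟩
  cases h' with
  | within _ _ _ _ => exact absurd h (lt_irrefl _)
  | forward _ _ _ _ _ h' => exact h'
  | backward _ _ _ _ hij _ => exact absurd h (lt_asymm hij)

theorem D_three_hasPattern : (D 3).HasPattern arcsD3 := by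
  have h01 : ∀ {A B C : Tournament} (a : A.V) (b : B.V),
      (delta3 A B C).Adj ⟨0, a⟩ ⟨1, b⟩ := fun a b => .forward 0 1 _ _ (by decide) (by decide)
  have h12 : ∀ {A B C : Tournament} (b : B.V) (c : C.V),
      (delta3 A B C).Adj ⟨1, b⟩ ⟨2, c⟩ := fun b c => .forward 1 2 _ _ (by decide) (by decide)
  have h20 : ∀ {A B C : Tournament} (c : C.V) (a : A.V),
      (delta3 A B C).Adj ⟨2, c⟩ ⟨0, a⟩ := fun c a => .backward 0 2 _ _ (by decide) (by decide)
  have h11 : ∀ {A B C : Tournament} {a b : B.V}, B.Adj a b →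
      (delta3 A B C).Adj ⟨1, a⟩ ⟨1, b⟩ := fun {A B C a b} h =>
      .within (n := 1) (T := ![A, B, C]) 1 a b h
  have h22 : ∀ {A B C : Tournament} {a b : C.V}, C.Adj a b →
      (delta3 A B C).Adj ⟨2, a⟩ ⟨2, b⟩ := fun {A B C a b} h =>
      .within (n := 1) (T := ![A, B, C]) 2 a b h
  obtain ⟨x, y, z, hxy, hyz, hzx⟩ : ∃ x y z : (D 2).V, (D 2).Adj x y ∧ (D 2).Adj y z ∧
      (D 2).Adj z x := ⟨_, _, _, h01 (A := I) (B := I) (C := I) () (), h12 (A := I) (B := I) (C := I) () (),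
      h20 (A := I) (B := I) (C := I) () ()⟩
  let v : (delta3 I (D 2) (D 2)).V := ⟨0, ()⟩
  -- The vertices are ordered as apex, first triangle, second triangle; the default `v` only fills
  -- indices beyond the pattern.
  refine ⟨fun i => [v, ⟨1, x⟩, ⟨1, y⟩, ⟨1, z⟩, ⟨2, x⟩, ⟨2, y⟩, ⟨2, z⟩].getD i v,
    fun i hi j hj h => ?_⟩
  change i < 7 at hi
  change j < 7 at hj
  interval_cases i <;> interval_cases j <;>
    first
    | exact absurd h (by decide)
    | exact h11 ‹_›
    | exact h22 ‹_›
    | exact h01 (A := I) () _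
    | exact h12 _ _
    | exact h20 (A := I) _ ()

theorem layered_adj_cases {X : Tournament} {m : ℕ} {u v : (layered X m).V}
    (h : (layered X m).Adj u v) :
    (u.1 = none ∧ v.1 = none → v.2 < u.2) ∧ (u.1 ≠ none ∧ v.1 = none → u.2 < v.2) ∧
      (v.1 ≠ none → u.2 ≤ v.2) := by
  obtain ⟨_ | x, i⟩ := u <;> obtain ⟨_ | y, j⟩ := v
  · exact ⟨fun _ => h, fun h => absurd rfl h.1, fun h => absurd rfl h⟩
  · exact ⟨fun h => (Option.some_ne_none _ h.2).elim, fun h => absurd rfl h.1, fun _ => h⟩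
  · exact ⟨fun h => (Option.some_ne_none _ h.1).elim, fun _ => h, fun h => absurd rfl h⟩
  · refine ⟨fun h => (Option.some_ne_none _ h.1).elim, fun h => (Option.some_ne_none _ h.2).elim,
      fun _ => ?_⟩
    rcases h with h | ⟨rfl, -⟩
    exacts [le_of_lt h, le_rfl]

theorem layered_triangle {X : Tournament} {m : ℕ} {u v w : (layered X m).V}
    (h : (layered X m).Adj u v) (h' : (layered X m).Adj v w) (h'' : (layered X m).Adj w u) :
    u.1 ≠ none ∨ v.1 ≠ none ∨ w.1 ≠ none := by
  by_contra! hn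
  exact lt_asymm ((layered_adj_cases h).1 ⟨hn.1, hn.2.1⟩)
    (((layered_adj_cases h'').1 ⟨hn.2.2, hn.1⟩).trans ((layered_adj_cases h').1 ⟨hn.2.1, hn.2.2⟩))

/-- D₃ consists of an apex and two cyclic triangles, joined cyclically. Each triangle leaves the
transitive spine somewhere, and comparing layer indices around the 3-cycles through the apex then
puts all seven vertices in one copy of `X`. -/
theorem HasPattern.of_layered {X : Tournament} {m : ℕ} (h : (layered X m).HasPattern arcsD3) :
    X.HasPattern arcsD3 := by
  obtain ⟨e, he⟩ := h
  have arc : ∀ i < 7, ∀ j < 7, maskAdj arcsD3 i j = true → (layered X m).Adj (e i) (e j) := he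
  obtain ⟨a, ha, hna⟩ : ∃ a ∈ Finset.Icc 1 3, (e a).1 ≠ none := by
    rcases layered_triangle (arc 1 (by decide) 2 (by decide) (by decide))
      (arc 2 (by decide) 3 (by decide) (by decide)) (arc 3 (by decide) 1 (by decide) (by decide))
      with h | h | h
    exacts [⟨1, by decide, h⟩, ⟨2, by decide, h⟩, ⟨3, by decide, h⟩]
  obtain ⟨b, hb, hnb⟩ : ∃ b ∈ Finset.Icc 4 6, (e b).1 ≠ none := by
    rcases layered_triangle (arc 4 (by decide) 5 (by decide) (by decide))
      (arc 5 (by decide) 6 (by decide) (by decide)) (arc 6 (by decide) 4 (by decide) (by decide))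
      with h | h | h
    exacts [⟨4, by decide, h⟩, ⟨5, by decide, h⟩, ⟨6, by decide, h⟩]
  have hva : ∀ a ∈ Finset.Icc 1 3, (layered X m).Adj (e 0) (e a) := fun a ha => by
    refine arc 0 (by decide) a ?_ ?_
    · simp at ha
      omega
    · revert ha a
      decide
  have hbv : ∀ b ∈ Finset.Icc 4 6, (layered X m).Adj (e b) (e 0) := fun b hb => by
    refine arc b ?_ 0 (by decide) ?_
    · simp at hb
      omega
    · revert hb b
      decide
  have hab : ∀ a ∈ Finset.Icc 1 3, ∀ b ∈ Finset.Icc 4 6, (layered X m).Adj (e a) (e b) :=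
    fun a ha b hb => by
    refine arc a ?_ b ?_ ?_
    · simp at ha
      omega
    · simp at hb
      omega
    · revert ha a hb b
      decide
  -- With the apex on the spine, the indices would satisfy apex ≤ a ≤ b < apex.
  have hn0 : (e 0).1 ≠ none := fun h0 => by
    have h1 := (layered_adj_cases (hva a ha)).2.2 hna
    have h2 := (layered_adj_cases (hbv b hb)).2.1 ⟨hnb, h0⟩
    have h3 := (layered_adj_cases (hab a ha b hb)).2.2 hnb
    omega
  -- If exactly one of a and b were on the spine, the 3-cycle through the apex would contain a
  -- strict increase of the index and no decrease.
  have key : ∀ a ∈ Finset.Icc 1 3, ∀ b ∈ Finset.Icc 4 6, ((e a).1 ≠ none ∨ (e b).1 ≠ none) →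
      (e a).1 ≠ none ∧ (e b).1 ≠ none ∧ (e a).2 = (e 0).2 ∧ (e b).2 = (e 0).2 := by
    intro a ha b hb h
    have h1 := layered_adj_cases (hva a ha)
    have h2 := (layered_adj_cases (hbv b hb)).2.2 hn0
    have h3 := layered_adj_cases (hab a ha b hb)
    by_cases hna : (e a).1 = none <;> by_cases hnb : (e b).1 = none
    · simp [hna, hnb] at h
    · have h1 := h1.2.1 ⟨hn0, hna⟩
      have h3 := h3.2.2 hnb
      omega
    · have h1 := h1.2.2 hna
      have h3 := h3.2.1 ⟨hna, hnb⟩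
      omega
    · have h1 := h1.2.2 hna
      have h3 := h3.2.2 hnb
      exact ⟨hna, hnb, by omega, by omega⟩
  have hall : ∀ i < 7, (e i).1 ≠ none ∧ (e i).2 = (e 0).2 := by
    intro i hi
    rcases Nat.eq_zero_or_pos i with rfl | hi0
    · exact ⟨hn0, rfl⟩
    · rcases Nat.lt_or_ge i 4 with h | h
      · have := key i (by simp; omega) b hb (Or.inr hnb)
        exact ⟨this.1, this.2.2.1⟩
      · have := key a ha i (by simp; omega) (Or.inl hna)
        exact ⟨this.2.1, this.2.2.2⟩
  have hx : ∀ i < 7, ∃ x, e i = (some x, (e 0).2) := fun i hi => by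
    obtain ⟨x, hx⟩ := Option.ne_none_iff_exists'.1 (hall i hi).1
    exact ⟨x, Prod.ext hx (hall i hi).2⟩
  have := X.nonempty
  choose! x hx using hx
  refine ⟨x, fun i hi j hj h => ?_⟩
  have := arc i hi j hj h
  rw [hx i hi, hx j hj] at this
  rcases this with h | ⟨-, h⟩
  exacts [absurd h (lt_irrefl _), h]

theorem layers_not_hasPattern_arcsD3 : ∀ k, ¬ (layers k).HasPattern arcsD3
  | 0 => fun ⟨_, he⟩ => he 0 (by decide) 1 (by decide) (by decide)
  | k + 1 => fun h => layers_not_hasPattern_arcsD3 k h.of_layered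

theorem IsHeroFor.exists_layers_contains {F H : Tournament} (hH : IsHeroFor F H)
    (hF : F.Contains (D 3)) : ∃ k, (layers k).Contains H :=
  hH.exists_contains hF layers_not_colorable fun k h =>
    layers_not_hasPattern_arcsD3 k (.of_contains h D_three_hasPattern)

/-- Since D₃ is itself `DescartesFree`, the tower avoids `F`, so `H` lies in a member of the tower
and inherits every pattern exclusion. -/
theorem IsHeroFor.not_hasPattern {F H : Tournament} (hH : IsHeroFor F H)
    (hF : F.Contains (D 3)) {O : List ℕ} (hO : DescartesFree O) : ¬ H.HasPattern O := by
  obtain ⟨k, hk⟩ := hH.exists_contains hF descartesTower_not_colorable fun k h =>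
    descartesFree_arcsD3.not_hasPattern_descartesTower k (.of_contains h D_three_hasPattern)
  exact fun h => hO.not_hasPattern_descartesTower k (.of_contains hk h)

/-! ### Recognising Δ and ⇒ from vertex partitions. -/

/-- The vertices of `H` with the property `P` induce a tournament isomorphic to `T`. -/
def IsoOn (H : Tournament) (P : H.V → Prop) (T : Tournament) : Prop :=
  Nonempty ((fun a b : {v // P v} => H.Adj a b) ≃r T.Adj)

theorem IsoOn.congr {H T : Tournament} {P Q : H.V → Prop} (h : H.IsoOn P T)
    (hPQ : ∀ v, P v ↔ Q v) : H.IsoOn Q T := by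
  obtain rfl : P = Q := funext fun v => propext (hPQ v)
  exact h

/-- The subtournament induced by the vertices with the property `P`. -/
def induce (H : Tournament) (P : H.V → Prop) (hP : ∃ v, P v) : Tournament where
  V := {v // P v}
  finite := by
    have := H.finite
    infer_instance
  nonempty := hP.elim fun v hv => ⟨⟨v, hv⟩⟩
  Adj a b := H.Adj a b
  irrefl v := H.irrefl v
  asymm u v := H.asymm u v
  total u v h := H.total u v fun e => h (Subtype.ext e)

theorem contains_induce {H : Tournament} {P : H.V → Prop} (hP : ∃ v, P v) :
    H.Contains (H.induce P hP) :=
  ⟨⟨Function.Embedding.subtype _, Iff.rfl⟩⟩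

theorem isoOn_induce {H : Tournament} {P : H.V → Prop} (hP : ∃ v, P v) :
    H.IsoOn P (H.induce P hP) :=
  ⟨RelIso.refl _⟩

theorem isoOn_I {H : Tournament} {P : H.V → Prop} {v : H.V} (hv : P v) (h : ∀ u, P u → u = v) :
    H.IsoOn P I := by
  have : Unique {v // P v} := ⟨⟨⟨v, hv⟩⟩, fun u => Subtype.ext (h u u.2)⟩
  refine ⟨⟨Equiv.ofUnique _ Unit, fun {a b} => ⟨False.elim, fun hab => ?_⟩⟩⟩
  rw [Subsingleton.elim a b] at hab
  exact H.irrefl _ hab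

/-- Without cyclic triangles the edge relation is transitive, hence a strict linear order. -/
theorem exists_isoOn_L {H : Tournament} {P : H.V → Prop} (hP : ∃ v, P v)
    (h : ∀ x y z, P x → P y → P z → H.Adj x y → H.Adj y z → ¬ H.Adj z x) :
    ∃ k, H.IsoOn P (L k) := by
  classical
  have := H.finite
  have := Fintype.ofFinite {v // P v}
  let r : {v // P v} → {v // P v} → Prop := fun a b => H.Adj a b
  have : IsStrictTotalOrder {v // P v} r :=
    { irrefl := fun a => H.irrefl a
      trans := fun a b c hab hbc => by
        have hac : a.1 ≠ c.1 := fun e => H.asymm _ _ hab (by rw [e]; exact hbc)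
        exact (H.total _ _ hac).resolve_right (h _ _ _ a.2 b.2 c.2 hab hbc)
      trichotomous := fun a b hab hba => by
        by_contra hne
        exact (H.total a b fun e => hne (Subtype.ext e)).elim hab hba }
  let _ : LinearOrder {v // P v} := linearOrderOfSTO r
  have hpos : 0 < Fintype.card {v // P v} :=
    Fintype.card_pos_iff.2 (hP.elim fun v hv => ⟨⟨v, hv⟩⟩)
  exact ⟨⟨_, hpos⟩, ⟨(Fintype.orderIsoFinOfCardEq {v // P v} rfl).symm.toRelIsoLT⟩⟩

theorem adj_iff_not_adj {H : Tournament} {u v : H.V} (h : u ≠ v) : H.Adj u v ↔ ¬ H.Adj v u :=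
  ⟨H.asymm u v, (H.total u v h).resolve_right⟩

/-- A partition of the vertices of `H` with the right edges between the parts shows that `H` is
isomorphic to some `Δ(T₁, …, T_{2n+1})`. -/
theorem isIso_delta {H : Tournament} {n : ℕ} {T : Fin (2 * n + 1) → Tournament}
    (f : H.V → Fin (2 * n + 1)) (hT : ∀ i, H.IsoOn (fun v => f v = i) (T i))
    (hf : ∀ u v, f u < f v → (H.Adj u v ↔ ¬ (Even (f u).val ∧ Even (f v).val))) :
    H.IsIso (delta T) := by
  have g : ∀ i, (fun a b : {v // f v = i} => H.Adj a b) ≃r (T i).Adj := fun i =>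
    Classical.choice (hT i)
  let F : H.V ≃ (delta T).V :=
    (Equiv.sigmaFiberEquiv f).symm.trans (Equiv.sigmaCongrRight fun i => (g i).toEquiv)
  have hlt : ∀ u v, f u < f v → ((delta T).Adj (F u) (F v) ↔ H.Adj u v) := fun u v h => by
    rw [delta_adj_of_lt (show (F u).1 < (F v).1 from h), hf u v h]
    rfl
  refine ⟨⟨F, fun {u v} => ?_⟩⟩
  rcases lt_trichotomy (f u) (f v) with h | h | h
  · exact hlt u v h
  -- A free index `i` allows both vertices to be rewritten into the same fibre despite the dependent
  -- types.
  · have key : ∀ i (hu : f u = i) (hv : f v = i),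
        (delta T).Adj (F u) (F v) ↔ H.Adj u v := by
      rintro i rfl hv
      have hFv : F v = ⟨f u, g (f u) ⟨v, hv⟩⟩ := by
        clear h
        generalize f u = i at hv
        subst hv
        rfl
      rw [hFv]
      exact delta_adj_same.trans (g (f u)).map_rel_iff
    exact key _ h rfl
  · rw [adj_iff_not_adj (H := H) (fun e => h.ne (by rw [e])),
      adj_iff_not_adj (H := delta T) (fun e => h.ne (by rw [F.injective e]))]
    exact not_congr (hlt v u h)

theorem isIso_arrow {H : Tournament} {P : H.V → Prop} (hP : ∃ v, P v) (hQ : ∃ v, ¬ P v)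
    (h : ∀ u v, P u → ¬ P v → H.Adj u v) :
    H.IsIso (arrow (H.induce P hP) (H.induce (fun v => ¬ P v) hQ)) := by
  classical
  refine ⟨(RelIso.symm ⟨Equiv.sumCompl P, fun {a b} => ?_⟩)⟩
  rcases a with a | a <;> rcases b with b | b
  · exact (Iff.refl (H.Adj a.1 b.1)).trans (Sum.lex_inl_inl (r := (H.induce P hP).Adj)
      (s := (H.induce (fun v => ¬ P v) hQ).Adj) (a₁ := a) (a₂ := b)).symm
  · exact iff_of_true (h _ _ a.2 b.2) (Sum.Lex.sep _ _)
  · exact iff_of_false (H.asymm _ _ (h _ _ b.2 a.2)) Sum.lex_inr_inl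
  · exact (Iff.refl (H.Adj a.1 b.1)).trans (Sum.lex_inr_inr (r := (H.induce P hP).Adj)
      (s := (H.induce (fun v => ¬ P v) hQ).Adj) (b₁ := a) (b₂ := b)).symm

/-! ### Layouts extracted from iterated layerings. -/

/-- A vertex placement in which vertices at even positions are alone at their position and point
backwards to each other, while all other edges between different positions go forward. -/
structure Layout (H : Tournament) (pos : H.V → ℕ) : Prop where
  adj_of_lt : ∀ u v, pos u < pos v → (H.Adj u v ↔ ¬ (pos u % 2 = 0 ∧ pos v % 2 = 0))
  inj : ∀ u v, pos u % 2 = 0 → pos u = pos v → u = v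

/-- Doubling the layer index leaves room for the spine vertex at `2 * i` and its copy of `X` at `2 *
i + 1`. -/
theorem layout_of_layered {H X : Tournament} {m : ℕ} (f : H.Adj ↪r (layered X m).Adj) :
    Layout H fun v => 2 * (f v).2.val + if (f v).1 = none then 0 else 1 := by
  constructor
  · intro u v
    rw [← f.map_rel_iff]
    generalize f u = a
    generalize f v = b
    obtain ⟨_ | x, i⟩ := a <;> obtain ⟨_ | y, j⟩ := b
    · intro h
      simp at h
      simp [layered, h.le]
    · intro h
      simp at h
      refine iff_of_true (show i ≤ j by omega) (by simp)
    · intro h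
      simp at h
      refine iff_of_true (show i < j by omega) (by simp)
    · intro h
      simp at h
      exact iff_of_true (Or.inl h) (by simp)
  · intro u v h h'
    apply f.injective
    revert h h'
    generalize f u = a
    generalize f v = b
    obtain ⟨_ | x, i⟩ := a <;> obtain ⟨_ | y, j⟩ := b
    · intro _ h
      simp at h
      rw [Fin.ext h]
    · intro _ h
      simp at h
      omega
    · intro h
      simp at h
    · intro h
      simp at h

/-- A tournament contained in an iterated layering has one vertex or a layout with at least two
positions. -/
theorem exists_layout {H : Tournament} : ∀ k, (layers k).Contains H →
    H.IsIso I ∨ ∃ pos : H.V → ℕ, Layout H pos ∧ ∃ u v, pos u ≠ pos v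
  | 0, ⟨f⟩ => by
    have : Subsingleton H.V := ⟨fun a b => f.injective (Subsingleton.elim (α := Unit) _ _)⟩
    have : Unique H.V := ⟨⟨H.nonempty.some⟩, fun a => Subsingleton.elim _ _⟩
    exact Or.inl ⟨⟨Equiv.ofUnique _ Unit, fun {a b} =>
      ⟨False.elim, fun hab => by rw [Subsingleton.elim a b] at hab; exact H.irrefl _ hab⟩⟩⟩
  | k + 1, ⟨f⟩ => by
    by_cases h : ∃ u v, (2 * (f u).2.val + if (f u).1 = none then 0 else 1) ≠
        2 * (f v).2.val + if (f v).1 = none then 0 else 1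
    · exact Or.inr ⟨_, layout_of_layered f, h⟩
    -- All of `H` sits at one position: an even one holds a single vertex, while an odd one places
    -- `H` in a single copy of the previous tournament, where the recursion continues.
    · push Not at h
      have hlay := layout_of_layered f
      obtain ⟨v⟩ := H.nonempty
      by_cases hv : (f v).1 = none
      · have hv0 : (2 * (f v).2.val + if (f v).1 = none then 0 else 1) % 2 = 0 := by
          rw [if_pos hv]
          omega
        have : Subsingleton H.V := ⟨fun a b =>
          (hlay.inj v a hv0 (h v a)).symm.trans (hlay.inj v b hv0 (h v b))⟩
        have : Unique H.V := ⟨⟨v⟩, fun a => Subsingleton.elim _ _⟩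
        exact Or.inl ⟨⟨Equiv.ofUnique _ Unit, fun {a b} =>
          ⟨False.elim, fun hab => by rw [Subsingleton.elim a b] at hab; exact H.irrefl _ hab⟩⟩⟩
      · have hx : ∀ u, ∃ x, f u = (some x, (f v).2) := fun u => by
          have h1 := h u v
          have hu : (f u).1 ≠ none := fun hu => by
            simp [hu, hv] at h1
            omega
          simp [hu, hv] at h1
          obtain ⟨x, hx⟩ := Option.ne_none_iff_exists'.1 hu
          exact ⟨x, Prod.ext hx (Fin.ext (by omega))⟩
        choose x hx using hx
        refine exists_layout k ⟨⟨⟨x, fun a b hab => ?_⟩, fun {a b} => ?_⟩⟩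
        · apply f.injective
          rw [hx a, hx b, hab]
        · rw [← f.map_rel_iff, hx a, hx b]
          exact ⟨fun h => Or.inr ⟨rfl, h⟩, fun h => h.elim (fun h => absurd h (lt_irrefl _)) And.right⟩

theorem Layout.forward {H : Tournament} {pos : H.V → ℕ} (hl : Layout H pos) {u v : H.V}
    (h : pos u < pos v) (h' : pos u % 2 = 1 ∨ pos v % 2 = 1) : H.Adj u v :=
  (hl.adj_of_lt u v h).2 (by omega)

theorem Layout.backward {H : Tournament} {pos : H.V → ℕ} (hl : Layout H pos) {u v : H.V}
    (h : pos u < pos v) (h' : pos u % 2 = 0 ∧ pos v % 2 = 0) : H.Adj v u :=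
  (H.total u v fun e => h.ne (by rw [e])).resolve_left fun h'' => (hl.adj_of_lt u v h).1 h'' h'

/-! ### The four forbidden patterns and how they appear in a layout. -/

/-- The arcs of `Δ(L_2, L_2, L_2)`. -/
def arcs222 : List ℕ := [14, 12, 56, 48, 35, 3]

theorem descartesFree_arcs222 : DescartesFree arcs222 := by decide +kernel

/-- Even positions point backwards, so the source of each even pair is the one at the larger
position. -/
theorem Layout.hasPattern_222 {H : Tournament} {pos : H.V → ℕ} (hl : Layout H pos)
    {x₀ x₁ y₀ y₁ z₀ z₁ : H.V}
    (hpar : pos x₀ % 2 = 0 ∧ pos x₁ % 2 = 0 ∧ pos y₀ % 2 = 1 ∧ pos y₁ % 2 = 1 ∧ pos z₀ % 2 = 0 ∧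
      pos z₁ % 2 = 0)
    (hlt : pos x₀ < pos y₀ ∧ pos x₀ < pos y₁ ∧ pos x₁ < pos y₀ ∧ pos x₁ < pos y₁ ∧
      pos y₀ < pos z₀ ∧ pos y₀ < pos z₁ ∧ pos y₁ < pos z₀ ∧ pos y₁ < pos z₁ ∧
      pos x₁ < pos x₀ ∧ pos z₁ < pos z₀)
    (h0 : H.Adj y₀ y₁) :
    H.HasPattern arcs222 := by
  refine ⟨fun i => [x₀, x₁, y₀, y₁, z₀, z₁].getD i x₀, fun i hi j hj h => ?_⟩
  change i < 6 at hi
  change j < 6 at hj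
  interval_cases i <;> interval_cases j <;>
    first
    | exact absurd h (by decide)
    | (simp only [List.getD_cons_zero, List.getD_cons_succ]
       first
       | assumption
       | exact hl.forward (by omega) (by omega)
       | exact hl.backward (by omega) (by omega))

/-- The arcs of `Δ(I, C₃, I, C₃, I)`, where `C₃` is the cyclic triangle. -/
def arcs1C1C1 : List ℕ := [238, 500, 504, 498, 225, 320, 384, 288, 17]

theorem descartesFree_arcs1C1C1 : DescartesFree arcs1C1C1 := by decide +kernel

theorem Layout.hasPattern_1C1C1 {H : Tournament} {pos : H.V → ℕ} (hl : Layout H pos)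
    {x a₀ a₁ a₂ y b₀ b₁ b₂ z : H.V}
    (hpar : pos x % 2 = 0 ∧ pos a₀ % 2 = 1 ∧ pos a₁ % 2 = 1 ∧ pos a₂ % 2 = 1 ∧ pos y % 2 = 0 ∧
      pos b₀ % 2 = 1 ∧ pos b₁ % 2 = 1 ∧ pos b₂ % 2 = 1 ∧ pos z % 2 = 0)
    (hlt : pos x < pos a₀ ∧ pos x < pos a₁ ∧ pos x < pos a₂ ∧ pos a₀ < pos y ∧ pos a₁ < pos y ∧
      pos a₂ < pos y ∧ pos y < pos b₀ ∧ pos y < pos b₁ ∧ pos y < pos b₂ ∧ pos b₀ < pos z ∧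
      pos b₁ < pos z ∧ pos b₂ < pos z)
    (h0 : H.Adj a₀ a₁)
    (h1 : H.Adj a₁ a₂)
    (h2 : H.Adj a₂ a₀)
    (h3 : H.Adj b₀ b₁)
    (h4 : H.Adj b₁ b₂)
    (h5 : H.Adj b₂ b₀) :
    H.HasPattern arcs1C1C1 := by
  refine ⟨fun i => [x, a₀, a₁, a₂, y, b₀, b₁, b₂, z].getD i x, fun i hi j hj h => ?_⟩
  change i < 9 at hi
  change j < 9 at hj
  interval_cases i <;> interval_cases j <;>
    first
    | exact absurd h (by decide)
    | (simp only [List.getD_cons_zero, List.getD_cons_succ]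
       first
       | assumption
       | exact hl.forward (by omega) (by omega)
       | exact hl.backward (by omega) (by omega))

/-- The arcs of `Δ(L_2, I, I, C₃, I)`, where `C₃` is the cyclic triangle. -/
def arcs211C1 : List ℕ := [118, 116, 248, 115, 160, 192, 144, 11]

theorem descartesFree_arcs211C1 : DescartesFree arcs211C1 := by decide +kernel

theorem Layout.hasPattern_211C1 {H : Tournament} {pos : H.V → ℕ} (hl : Layout H pos)
    {x₀ x₁ a y b₀ b₁ b₂ z : H.V}
    (hpar : pos x₀ % 2 = 0 ∧ pos x₁ % 2 = 0 ∧ pos a % 2 = 1 ∧ pos y % 2 = 0 ∧ pos b₀ % 2 = 1 ∧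
      pos b₁ % 2 = 1 ∧ pos b₂ % 2 = 1 ∧ pos z % 2 = 0)
    (hlt : pos x₀ < pos a ∧ pos x₁ < pos a ∧ pos a < pos y ∧ pos y < pos b₀ ∧ pos y < pos b₁ ∧
      pos y < pos b₂ ∧ pos b₀ < pos z ∧ pos b₁ < pos z ∧ pos b₂ < pos z ∧ pos x₁ < pos x₀)
    (h0 : H.Adj b₀ b₁)
    (h1 : H.Adj b₁ b₂)
    (h2 : H.Adj b₂ b₀) :
    H.HasPattern arcs211C1 := by
  refine ⟨fun i => [x₀, x₁, a, y, b₀, b₁, b₂, z].getD i x₀, fun i hi j hj h => ?_⟩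
  change i < 8 at hi
  change j < 8 at hj
  interval_cases i <;> interval_cases j <;>
    first
    | exact absurd h (by decide)
    | (simp only [List.getD_cons_zero, List.getD_cons_succ]
       first
       | assumption
       | exact hl.forward (by omega) (by omega)
       | exact hl.backward (by omega) (by omega))

/-- The arcs of `Δ(I, C₃, I, I, L_2)`, where `C₃` is the cyclic triangle. -/
def arcs1C112 : List ℕ := [46, 244, 248, 242, 33, 192, 145, 17]

theorem descartesFree_arcs1C112 : DescartesFree arcs1C112 := by decide +kernel

theorem Layout.hasPattern_1C112 {H : Tournament} {pos : H.V → ℕ} (hl : Layout H pos)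
    {x a₀ a₁ a₂ y b z₀ z₁ : H.V}
    (hpar : pos x % 2 = 0 ∧ pos a₀ % 2 = 1 ∧ pos a₁ % 2 = 1 ∧ pos a₂ % 2 = 1 ∧ pos y % 2 = 0 ∧
      pos b % 2 = 1 ∧ pos z₀ % 2 = 0 ∧ pos z₁ % 2 = 0)
    (hlt : pos x < pos a₀ ∧ pos x < pos a₁ ∧ pos x < pos a₂ ∧ pos a₀ < pos y ∧ pos a₁ < pos y ∧
      pos a₂ < pos y ∧ pos y < pos b ∧ pos b < pos z₀ ∧ pos b < pos z₁ ∧ pos z₁ < pos z₀)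
    (h0 : H.Adj a₀ a₁)
    (h1 : H.Adj a₁ a₂)
    (h2 : H.Adj a₂ a₀) :
    H.HasPattern arcs1C112 := by
  refine ⟨fun i => [x, a₀, a₁, a₂, y, b, z₀, z₁].getD i x, fun i hi j hj h => ?_⟩
  change i < 8 at hi
  change j < 8 at hj
  interval_cases i <;> interval_cases j <;>
    first
    | exact absurd h (by decide)
    | (simp only [List.getD_cons_zero, List.getD_cons_succ]
       first
       | assumption
       | exact hl.forward (by omega) (by omega)
       | exact hl.backward (by omega) (by omega))

/-! ### Dichotomies for the parts, and decompositions of layouts. -/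

theorem exists_isoOn_L_or_triangle {H : Tournament} {P : H.V → Prop} (hP : ∃ v, P v) :
    (∃ k, H.IsoOn P (L k)) ∨
      ∃ x y z, (P x ∧ P y ∧ P z) ∧ H.Adj x y ∧ H.Adj y z ∧ H.Adj z x := by
  by_contra! h
  obtain ⟨k, hk⟩ := exists_isoOn_L hP fun x y z hx hy hz => h.2 x y z ⟨hx, hy, hz⟩
  exact h.1 k hk

theorem isoOn_I_or_exists_ne {H : Tournament} {P : H.V → Prop} {v : H.V} (hv : P v) :
    H.IsoOn P I ∨ ∃ u, P u ∧ u ≠ v := by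
  by_contra! h
  exact h.1 (isoOn_I hv h.2)

theorem exists_min_of_exists {H : Tournament} (pos : H.V → ℕ) {P : H.V → Prop} (hP : ∃ v, P v) :
    ∃ v, P v ∧ ∀ u, P u → pos v ≤ pos u := by
  have := H.finite
  have : Nonempty {v // P v} := nonempty_subtype.2 hP
  obtain ⟨v, hv⟩ := Finite.exists_min fun v : {v // P v} => pos v
  exact ⟨v, v.2, fun u hu => hv ⟨u, hu⟩⟩

theorem exists_max_of_exists {H : Tournament} (pos : H.V → ℕ) {P : H.V → Prop} (hP : ∃ v, P v) :
    ∃ v, P v ∧ ∀ u, P u → pos u ≤ pos v := by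
  have := H.finite
  have : Nonempty {v // P v} := nonempty_subtype.2 hP
  obtain ⟨v, hv⟩ := Finite.exists_max fun v : {v // P v} => pos v
  exact ⟨v, v.2, fun u hu => hv ⟨u, hu⟩⟩

theorem isIso_delta3 {H A B C : Tournament} {P Q R : H.V → Prop} (hcover : ∀ v, P v ∨ Q v ∨ R v)
    (hPQ : ∀ u v, P u → Q v → H.Adj u v) (hQR : ∀ u v, Q u → R v → H.Adj u v)
    (hRP : ∀ u v, R u → P v → H.Adj u v) (hA : H.IsoOn P A) (hB : H.IsoOn Q B)
    (hC : H.IsoOn R C) : H.IsIso (delta3 A B C) := by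
  classical
  have hnP : ∀ v, P v → ¬ Q v ∧ ¬ R v := fun v h =>
    ⟨fun h' => H.irrefl v (hPQ v v h h'), fun h' => H.irrefl v (hRP v v h' h)⟩
  have hnQ : ∀ v, Q v → ¬ R v := fun v h h' => H.irrefl v (hQR v v h h')
  have hR : ∀ v, ¬ P v → ¬ Q v → R v := fun v h h' => ((hcover v).resolve_left h).resolve_left h'
  refine isIso_delta (fun v => if P v then 0 else if Q v then 1 else 2) (fun i => ?_) fun u v => ?_
  · fin_cases i
    · exact hA.congr fun v => by split_ifs <;> simp [*]
    · exact hB.congr fun v => by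
        have := hnP v
        split_ifs <;> simp_all
    · exact hC.congr fun v => by
        have := hnP v
        have := hnQ v
        have := hR v
        split_ifs <;> simp_all
  · split_ifs with h1 h2 h3 h4 h5 h6 h7 <;> intro h
    all_goals first
      | exact absurd h (by decide)
      | exact iff_of_true (hPQ _ _ ‹_› ‹_›) (by decide)
      | exact iff_of_true (hQR _ _ ‹_› (hR _ ‹_› ‹_›)) (by decide)
      | exact iff_of_false (H.asymm _ _ (hRP _ _ (hR _ ‹_› ‹_›) ‹_›)) (by decide)

namespace Layout

variable {H : Tournament} {pos : H.V → ℕ}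

/-- Every edge between even positions strictly lowers the position, so no cycle can close. -/
theorem exists_isoOn_L_of_even (hl : Layout H pos) {P : H.V → Prop} (hP : ∃ v, P v)
    (h : ∀ v, P v → pos v % 2 = 0) : ∃ k, H.IsoOn P (L k) := by
  refine exists_isoOn_L hP fun x y z hx hy hz hxy hyz hzx => ?_
  have key : ∀ u v, P u → P v → H.Adj u v → pos v < pos u := fun u v hu hv huv => by
    by_contra! hle
    rcases hle.lt_or_eq with hlt | heq
    · exact H.asymm _ _ huv (hl.backward hlt ⟨h u hu, h v hv⟩)
    · exact huv.ne (hl.inj u v (h u hu) heq)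
  have h1 := key x y hx hy hxy
  have h2 := key y z hy hz hyz
  have h3 := key z x hz hx hzx
  omega

theorem pos_ne (hl : Layout H pos) {u v : H.V} (hu : pos u % 2 = 0) (h : u ≠ v) :
    pos u ≠ pos v := fun e => h (hl.inj u v hu e)

/-- The workhorse of the classification: the pairs come unordered, and sorting them gives
Δ(L₂,L₂,L₂). The positions within each pair need not be consecutive. -/
theorem false_of_two_two_two (hl : Layout H pos) (hO : ¬ H.HasPattern arcs222)
    {x x' y y' z z' : H.V} (hx : x ≠ x') (hy : y ≠ y') (hz : z ≠ z')
    (hpar : pos x % 2 = 0 ∧ pos x' % 2 = 0 ∧ pos y % 2 = 1 ∧ pos y' % 2 = 1 ∧ pos z % 2 = 0 ∧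
      pos z' % 2 = 0)
    (hlt : pos x < pos y ∧ pos x < pos y' ∧ pos x' < pos y ∧ pos x' < pos y' ∧
      pos y < pos z ∧ pos y < pos z' ∧ pos y' < pos z ∧ pos y' < pos z') : False := by
  rcases lt_or_gt_of_ne (hl.pos_ne hpar.1 hx) with h1 | h1 <;>
  rcases lt_or_gt_of_ne (hl.pos_ne hpar.2.2.2.2.1 hz) with h2 | h2 <;>
  rcases H.total y y' hy with h3 | h3
  · exact hO (hl.hasPattern_222 (x₀ := x') (x₁ := x) (z₀ := z') (z₁ := z) (by omega) (by omega) h3)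
  · exact hO (hl.hasPattern_222 (x₀ := x') (x₁ := x) (z₀ := z') (z₁ := z) (by omega) (by omega) h3)
  · exact hO (hl.hasPattern_222 (x₀ := x') (x₁ := x) (z₀ := z) (z₁ := z') (by omega) (by omega) h3)
  · exact hO (hl.hasPattern_222 (x₀ := x') (x₁ := x) (z₀ := z) (z₁ := z') (by omega) (by omega) h3)
  · exact hO (hl.hasPattern_222 (x₀ := x) (x₁ := x') (z₀ := z') (z₁ := z) (by omega) (by omega) h3)
  · exact hO (hl.hasPattern_222 (x₀ := x) (x₁ := x') (z₀ := z') (z₁ := z) (by omega) (by omega) h3)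
  · exact hO (hl.hasPattern_222 (x₀ := x) (x₁ := x') (z₀ := z) (z₁ := z') (by omega) (by omega) h3)
  · exact hO (hl.hasPattern_222 (x₀ := x) (x₁ := x') (z₀ := z) (z₁ := z') (by omega) (by omega) h3)

theorem monotone_ite_lt {f : ℕ → ℕ} {c : ℕ} (t : ℕ) (hf : Monotone f) (hc : ∀ p, c ≤ f p) :
    Monotone fun p => if p < t then c else f p := by
  intro a b hab
  dsimp only
  split_ifs with h1 h2
  exacts [le_rfl, hc b, absurd (hab.trans_lt ‹_›) h1, hf hab]

/-- A partition into intervals of positions, alternately even and odd, gives an isomorphism with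
some `Δ(T₁, …, T_{2n+1})`. -/
theorem isIso_delta (hl : Layout H pos) {n : ℕ} {T : Fin (2 * n + 1) → Tournament} (g : H.V → ℕ)
    (hg : ∀ v, g v < 2 * n + 1) (hmono : ∀ u v, g u < g v → pos u < pos v)
    (hpar : ∀ v, g v % 2 = pos v % 2) (hT : ∀ i, H.IsoOn (fun v => g v = i.val) (T i)) :
    H.IsIso (delta T) := by
  refine Tournament.isIso_delta (fun v => ⟨g v, hg v⟩)
    (fun i => (hT i).congr fun v => by rw [Fin.ext_iff]) fun u v h => ?_
  rw [hl.adj_of_lt u v (hmono u v h), Nat.even_iff, Nat.even_iff, hpar, hpar]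

theorem isIso_delta5 (hl : Layout H pos) {t₁ t₂ t₃ t₄ : ℕ} (ht : t₁ ≤ t₂ ∧ t₂ ≤ t₃ ∧ t₃ ≤ t₄)
    (hpar : ∀ v, (pos v < t₁ → pos v % 2 = 0) ∧ (t₁ ≤ pos v → pos v < t₂ → pos v % 2 = 1) ∧
      (t₂ ≤ pos v → pos v < t₃ → pos v % 2 = 0) ∧ (t₃ ≤ pos v → pos v < t₄ → pos v % 2 = 1) ∧
      (t₄ ≤ pos v → pos v % 2 = 0))
    {A B C D E : Tournament} (hA : H.IsoOn (fun v => pos v < t₁) A)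
    (hB : H.IsoOn (fun v => t₁ ≤ pos v ∧ pos v < t₂) B)
    (hC : H.IsoOn (fun v => t₂ ≤ pos v ∧ pos v < t₃) C)
    (hD : H.IsoOn (fun v => t₃ ≤ pos v ∧ pos v < t₄) D)
    (hE : H.IsoOn (fun v => t₄ ≤ pos v) E) : H.IsIso (delta5 A B C D E) := by
  let part : ℕ → ℕ := fun p => if p < t₁ then 0 else if p < t₂ then 1 else
    if p < t₃ then 2 else if p < t₄ then 3 else 4
  have hpart : Monotone part := by
    refine monotone_ite_lt _ ?_ fun p => by split_ifs <;> omega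
    refine monotone_ite_lt _ ?_ fun p => by split_ifs <;> omega
    refine monotone_ite_lt _ ?_ fun p => by split_ifs <;> omega
    exact monotone_ite_lt _ monotone_const fun p => by omega
  refine hl.isIso_delta (fun v => if pos v < t₁ then 0 else if pos v < t₂ then 1 else
    if pos v < t₃ then 2 else if pos v < t₄ then 3 else 4) (fun v => ?_)
    (fun u v h => Monotone.reflect_lt (f := part) hpart h)
    (fun v => ?_) fun i => ?_
  · split_ifs <;> omega
  · have := hpar v
    split_ifs <;> omega
  · fin_cases i
    · exact hA.congr fun v => by split_ifs <;> simp <;> omega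
    · exact hB.congr fun v => by split_ifs <;> simp <;> omega
    · exact hC.congr fun v => by split_ifs <;> simp <;> omega
    · exact hD.congr fun v => by split_ifs <;> simp <;> omega
    · exact hE.congr fun v => by split_ifs <;> simp <;> omega

theorem isIso_delta7 (hl : Layout H pos) {t₁ t₂ t₃ t₄ t₅ t₆ : ℕ}
    (ht : t₁ ≤ t₂ ∧ t₂ ≤ t₃ ∧ t₃ ≤ t₄ ∧ t₄ ≤ t₅ ∧ t₅ ≤ t₆)
    (hpar : ∀ v, (pos v < t₁ → pos v % 2 = 0) ∧ (t₁ ≤ pos v → pos v < t₂ → pos v % 2 = 1) ∧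
      (t₂ ≤ pos v → pos v < t₃ → pos v % 2 = 0) ∧ (t₃ ≤ pos v → pos v < t₄ → pos v % 2 = 1) ∧
      (t₄ ≤ pos v → pos v < t₅ → pos v % 2 = 0) ∧ (t₅ ≤ pos v → pos v < t₆ → pos v % 2 = 1) ∧
      (t₆ ≤ pos v → pos v % 2 = 0))
    {A B C D E F G : Tournament} (hA : H.IsoOn (fun v => pos v < t₁) A)
    (hB : H.IsoOn (fun v => t₁ ≤ pos v ∧ pos v < t₂) B)
    (hC : H.IsoOn (fun v => t₂ ≤ pos v ∧ pos v < t₃) C)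
    (hD : H.IsoOn (fun v => t₃ ≤ pos v ∧ pos v < t₄) D)
    (hE : H.IsoOn (fun v => t₄ ≤ pos v ∧ pos v < t₅) E)
    (hF : H.IsoOn (fun v => t₅ ≤ pos v ∧ pos v < t₆) F)
    (hG : H.IsoOn (fun v => t₆ ≤ pos v) G) : H.IsIso (delta7 A B C D E F G) := by
  let part : ℕ → ℕ := fun p => if p < t₁ then 0 else if p < t₂ then 1 else
    if p < t₃ then 2 else if p < t₄ then 3 else if p < t₅ then 4 else if p < t₆ then 5 else 6
  have hpart : Monotone part := by
    refine monotone_ite_lt _ ?_ fun p => by split_ifs <;> omega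
    refine monotone_ite_lt _ ?_ fun p => by split_ifs <;> omega
    refine monotone_ite_lt _ ?_ fun p => by split_ifs <;> omega
    refine monotone_ite_lt _ ?_ fun p => by split_ifs <;> omega
    refine monotone_ite_lt _ ?_ fun p => by split_ifs <;> omega
    exact monotone_ite_lt _ monotone_const fun p => by omega
  refine hl.isIso_delta (fun v => if pos v < t₁ then 0 else if pos v < t₂ then 1 else
    if pos v < t₃ then 2 else if pos v < t₄ then 3 else if pos v < t₅ then 4 else
    if pos v < t₆ then 5 else 6) (fun v => ?_)
    (fun u v h => Monotone.reflect_lt (f := part) hpart h) (fun v => ?_) fun i => ?_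
  · split_ifs <;> omega
  · have := hpar v
    split_ifs <;> omega
  · fin_cases i
    · exact hA.congr fun v => by split_ifs <;> simp <;> omega
    · exact hB.congr fun v => by split_ifs <;> simp <;> omega
    · exact hC.congr fun v => by split_ifs <;> simp <;> omega
    · exact hD.congr fun v => by split_ifs <;> simp <;> omega
    · exact hE.congr fun v => by split_ifs <;> simp <;> omega
    · exact hF.congr fun v => by split_ifs <;> simp <;> omega
    · exact hG.congr fun v => by split_ifs <;> simp <;> omega

/-- In a strongly connected tournament, the first and the last position are even and some
position is odd. -/
theorem exists_extremal (hl : Layout H pos) (hne : ∃ u v, pos u ≠ pos v)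
    (hs : ∀ P : H.V → Prop, (∃ v, P v) → (∃ v, ¬ P v) → ∃ u v, P u ∧ ¬ P v ∧ H.Adj v u) :
    (∃ e, pos e % 2 = 0 ∧ ∀ v, pos e ≤ pos v) ∧ (∃ e, pos e % 2 = 0 ∧ ∀ v, pos v ≤ pos e) ∧
      ∃ q, pos q % 2 = 1 := by
  obtain ⟨a, b, hab⟩ := hne
  have hother : ∀ e, ∃ v, pos v ≠ pos e := fun e => by
    by_contra! h
    exact hab ((h a).trans (h b).symm)
  obtain ⟨e, -, he⟩ := exists_min_of_exists pos (P := fun _ => True) ⟨a, trivial⟩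
  obtain ⟨e', -, he'⟩ := exists_max_of_exists pos (P := fun _ => True) ⟨a, trivial⟩
  -- An odd first position would dominate all other vertices, contradicting strong connectivity; the
  -- last position is treated dually.
  have he0 : pos e % 2 = 0 := by
    by_contra h0
    obtain ⟨u, v, hu, hv, hvu⟩ := hs (fun v => pos v = pos e) ⟨e, rfl⟩ (hother e)
    have := he v trivial
    exact H.asymm _ _ hvu (hl.forward (by omega) (by omega))
  have he0' : pos e' % 2 = 0 := by
    by_contra h0
    obtain ⟨u, v, hu, hv, hvu⟩ := hs (fun v => pos v ≠ pos e') (hother e') ⟨e', by simp⟩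
    have := he' u trivial
    exact H.asymm _ _ hvu (hl.forward (by omega) (by omega))
  refine ⟨⟨e, he0, fun v => he v trivial⟩, ⟨e', he0', fun v => he' v trivial⟩, ?_⟩
  by_contra! h
  obtain ⟨u, v, hu, hv, hvu⟩ := hs (fun v => pos v = pos e') ⟨e', rfl⟩ (hother e')
  have h1 := he' v trivial
  have h2 := h v
  exact H.asymm _ _ hvu (hl.backward (by omega) (by omega))

/-! ### Classification by the number of runs of odd positions. -/

/-- The case in which the odd positions form an interval. -/
theorem classification_one_block {F : Tournament} (hl : Layout H pos) (hH : IsHeroFor F H)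
    (hO : ¬ H.HasPattern arcs222) {e e' q q' : H.V}
    (he : pos e % 2 = 0 ∧ ∀ v, pos e ≤ pos v) (he' : pos e' % 2 = 0 ∧ ∀ v, pos v ≤ pos e')
    (hq : pos q % 2 = 1 ∧ ∀ v, pos v % 2 = 1 → pos q ≤ pos v)
    (hq' : pos q' % 2 = 1 ∧ ∀ v, pos v % 2 = 1 → pos v ≤ pos q')
    (hmid : ∀ v, pos q < pos v → pos v < pos q' → pos v % 2 = 1) :
    ∃ (k : ℕ+) (H' : Tournament), IsHeroFor F H' ∧
      (H.IsIso (delta3 I (L k) H') ∨ H.IsIso (delta3 I H' (L k))) := by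
  have hqe := he.2 q
  have hqe' := he'.2 q'
  have hqq := hq.2 q' hq'.1
  have hlow : ∃ v, pos v < pos q := ⟨e, by omega⟩
  have hmidq : ∃ v, pos q ≤ pos v ∧ pos v ≤ pos q' := ⟨q, le_rfl, hqq⟩
  have hhigh : ∃ v, pos q' < pos v := ⟨e', by omega⟩
  have heven : ∀ v, (pos v < pos q → pos v % 2 = 0) ∧ (pos q' < pos v → pos v % 2 = 0) :=
    fun v => by
    have h1 := hq.2 v
    have h2 := hq'.2 v
    omega
  have hodd : ∀ v, pos q ≤ pos v → pos v ≤ pos q' → pos v % 2 = 1 := fun v h1 h2 => by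
    by_contra h
    exact h (hmid v (by omega) (by omega))
  obtain ⟨k, hk⟩ := hl.exists_isoOn_L_of_even hlow fun v => (heven v).1
  obtain ⟨k', hk'⟩ := hl.exists_isoOn_L_of_even hhigh fun v => (heven v).2
  have hcover : ∀ v, pos v < pos q ∨ (pos q ≤ pos v ∧ pos v ≤ pos q') ∨ pos q' < pos v := by
    intro v
    omega
  have h01 : ∀ u v, pos u < pos q → pos q ≤ pos v ∧ pos v ≤ pos q' → H.Adj u v :=
    fun u v hu hv => hl.forward (by omega) (Or.inr (hodd v hv.1 hv.2))
  have h12 : ∀ u v, pos q ≤ pos u ∧ pos u ≤ pos q' → pos q' < pos v → H.Adj u v :=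
    fun u v hu hv => hl.forward (by omega) (Or.inl (hodd u hu.1 hu.2))
  have h20 : ∀ u v, pos q' < pos u → pos v < pos q → H.Adj u v :=
    fun u v hu hv => hl.backward (by omega) ⟨(heven v).1 hv, (heven u).2 hu⟩
  -- One of the three parts must be a single vertex. Since Δ(A, B, C) is invariant under cyclic
  -- rotation, that part can be moved to the front.
  rcases isoOn_I_or_exists_ne (P := fun v => pos v < pos q) (v := e) (by omega)
    with h1 | ⟨x, hx, hxe⟩
  · exact ⟨k', _, hH.mono (contains_induce hmidq), Or.inr
      (isIso_delta3 hcover h01 h12 h20 h1 (isoOn_induce hmidq) hk')⟩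
  rcases isoOn_I_or_exists_ne (P := fun v => pos q' < pos v) (v := e') (by omega)
    with h2 | ⟨z, hz, hze⟩
  · exact ⟨k, _, hH.mono (contains_induce hmidq), Or.inl
      (isIso_delta3 (fun v => by have := hcover v; tauto) h20 h01 h12 h2 hk (isoOn_induce hmidq))⟩
  rcases isoOn_I_or_exists_ne (P := fun v => pos q ≤ pos v ∧ pos v ≤ pos q') (v := q)
    ⟨le_rfl, hqq⟩ with h3 | ⟨y, hy, hyq⟩
  · exact ⟨k', _, hH.mono (contains_induce hlow), Or.inl
      (isIso_delta3 (fun v => by have := hcover v; tauto) h12 h20 h01 h3 hk' (isoOn_induce hlow))⟩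
  exfalso
  have := (heven x).1 hx
  have := (heven z).2 hz
  have := hodd y hy.1 hy.2
  exact hl.false_of_two_two_two hO hxe hyq hze (by omega) (by omega)

/-- The case in which the odd positions form two intervals. -/
theorem classification_two_blocks {F : Tournament} (hl : Layout H pos) (hH : IsHeroFor F H)
    (hO₁ : ¬ H.HasPattern arcs222) (hO₂ : ¬ H.HasPattern arcs1C1C1)
    (hO₃ : ¬ H.HasPattern arcs211C1) (hO₄ : ¬ H.HasPattern arcs1C112) {e e' q q' s s' : H.V}
    (he : pos e % 2 = 0 ∧ ∀ v, pos e ≤ pos v) (he' : pos e' % 2 = 0 ∧ ∀ v, pos v ≤ pos e')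
    (hq : pos q % 2 = 1 ∧ ∀ v, pos v % 2 = 1 → pos q ≤ pos v)
    (hq' : pos q' % 2 = 1 ∧ ∀ v, pos v % 2 = 1 → pos v ≤ pos q')
    (hs : pos s % 2 = 0 ∧ pos q < pos s ∧ ∀ v, pos v % 2 = 0 → pos q < pos v → pos s ≤ pos v)
    (hs' : pos s' % 2 = 0 ∧ pos s' < pos q' ∧
      ∀ v, pos v % 2 = 0 → pos v < pos q' → pos v ≤ pos s') (hss : pos s ≤ pos s')
    (hmid : ∀ v, pos s ≤ pos v → pos v ≤ pos s' → pos v % 2 = 0) :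
    (∃ k₁ k₂ k₃ : ℕ+, H.IsIso (delta5 (L k₁) I (L k₂) (L k₃) I) ∨
      H.IsIso (delta5 I (L k₁) (L k₂) I (L k₃))) ∨
    ∃ (k₁ k₂ : ℕ+) (H' : Tournament), IsHeroFor F H' ∧
      (H.IsIso (delta5 I H' (L k₁) (L k₂) I) ∨ H.IsIso (delta5 I (L k₁) (L k₂) H' I)) := by
  have hqe := he.2 q
  have hqe' := he'.2 q'
  have key : ∀ v, (pos v < pos q → pos v % 2 = 0) ∧
      (pos q ≤ pos v → pos v < pos s → pos v % 2 = 1) ∧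
      (pos s ≤ pos v → pos v < pos s' + 1 → pos v % 2 = 0) ∧
      (pos s' + 1 ≤ pos v → pos v < pos q' + 1 → pos v % 2 = 1) ∧
      (pos q' + 1 ≤ pos v → pos v % 2 = 0) := fun v => by
    have h1 := hq.2 v
    have h2 := hq'.2 v
    have h3 := hs.2.2 v
    have h4 := hs'.2.2 v
    have h5 := hmid v
    omega
  -- The runs are half-open intervals, so the last even position `pos s'` and the last odd position
  -- `pos q'` need a `+ 1`.
  have hiso := fun {A B C D E : Tournament} => hl.isIso_delta5 (t₁ := pos q) (t₂ := pos s)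
    (t₃ := pos s' + 1) (t₄ := pos q' + 1) (A := A) (B := B) (C := C) (D := D) (E := E)
    ⟨hs.2.1.le, by omega, by omega⟩ key
  have hB : ∃ v, pos q ≤ pos v ∧ pos v < pos s := ⟨q, le_rfl, hs.2.1⟩
  have hD : ∃ v, pos s' + 1 ≤ pos v ∧ pos v < pos q' + 1 := ⟨q', hs'.2.1, by omega⟩
  obtain ⟨k, hk⟩ := hl.exists_isoOn_L_of_even (P := fun v => pos s ≤ pos v ∧ pos v < pos s' + 1)
    ⟨s, by omega⟩ fun v hv => (key v).2.2.1 hv.1 hv.2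
  rcases isoOn_I_or_exists_ne (P := fun v => pos v < pos q) (v := e) (by omega)
    with hA | ⟨x, hx, hxe⟩ <;>
  rcases isoOn_I_or_exists_ne (P := fun v => pos q' + 1 ≤ pos v) (v := e') (by omega)
    with hE | ⟨z, hz, hze⟩
  · right
    rcases exists_isoOn_L_or_triangle hD with ⟨k', hk'⟩ | ⟨b₀, b₁, b₂, hb, b01, b12, b20⟩
    · exact ⟨k, k', _, hH.mono (contains_induce hB),
        Or.inl (hiso hA (isoOn_induce hB) hk hk' hE)⟩
    rcases exists_isoOn_L_or_triangle hB with ⟨k', hk'⟩ | ⟨a₀, a₁, a₂, ha, a01, a12, a20⟩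
    · exact ⟨k', k, _, hH.mono (contains_induce hD),
        Or.inr (hiso hA hk' hk (isoOn_induce hD) hE)⟩
    exfalso
    have := (key a₀).2.1
    have := (key a₁).2.1
    have := (key a₂).2.1
    have := (key b₀).2.2.2.1
    have := (key b₁).2.2.2.1
    have := (key b₂).2.2.2.1
    exact hO₂ (hl.hasPattern_1C1C1 (x := e) (y := s) (z := e') (by omega) (by omega)
      a01 a12 a20 b01 b12 b20)
  · left
    have hz0 := (key z).2.2.2.2 hz
    obtain ⟨k₃, hk₃⟩ := hl.exists_isoOn_L_of_even ⟨z, hz⟩ fun v => (key v).2.2.2.2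
    -- With at least two vertices in the last run, a second vertex in the second odd run would give
    -- Δ(L₂,L₂,L₂), using `e` and `s` before it.
    rcases isoOn_I_or_exists_ne (P := fun v => pos s' + 1 ≤ pos v ∧ pos v < pos q' + 1) (v := q')
      (by omega) with hI | ⟨y, hy, hyq⟩
    · rcases exists_isoOn_L_or_triangle hB with ⟨k', hk'⟩ | ⟨a₀, a₁, a₂, ha, a01, a12, a20⟩
      · exact ⟨k', k, k₃, Or.inr (hiso hA hk' hk hI hk₃)⟩
      exfalso
      have := (key a₀).2.1
      have := (key a₁).2.1
      have := (key a₂).2.1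
      rcases lt_or_gt_of_ne (hl.pos_ne hz0 hze) with h | h
      · exact hO₄ (hl.hasPattern_1C112 (x := e) (y := s) (b := q') (z₀ := e') (z₁ := z)
          (by omega) (by omega) a01 a12 a20)
      · exact absurd (he'.2 z) (by omega)
    · exfalso
      have := (key y).2.2.2.1 hy.1 hy.2
      exact hl.false_of_two_two_two hO₁ (x := e) (x' := s) (z := z) (z' := e')
        (fun h => by subst h; omega) hyq hze (by omega) (by omega)
  · left
    have := (key x).1 hx
    obtain ⟨k₁, hk₁⟩ := hl.exists_isoOn_L_of_even ⟨x, hx⟩ fun v => (key v).1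
    rcases isoOn_I_or_exists_ne (P := fun v => pos q ≤ pos v ∧ pos v < pos s) (v := q)
      (by omega) with hI | ⟨y, hy, hyq⟩
    · rcases exists_isoOn_L_or_triangle hD with ⟨k', hk'⟩ | ⟨b₀, b₁, b₂, hb, b01, b12, b20⟩
      · exact ⟨k₁, k, k', Or.inl (hiso hk₁ hI hk hk' hE)⟩
      exfalso
      have := (key b₀).2.2.2.1
      have := (key b₁).2.2.2.1
      have := (key b₂).2.2.2.1
      have hxe' := hl.pos_ne ((key x).1 hx) hxe
      have := he.2 x
      exact hO₃ (hl.hasPattern_211C1 (x₀ := x) (x₁ := e) (a := q) (y := s) (z := e')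
          (by omega) (by omega) b01 b12 b20)
    · exfalso
      have := (key y).2.1 hy.1 hy.2
      exact hl.false_of_two_two_two hO₁ (x := x) (x' := e) (z := s) (z' := e')
        hxe hyq (fun h => by subst h; omega) (by omega) (by omega)
  · exfalso
    have := (key x).1 hx
    have := (key z).2.2.2.2 hz
    -- If both end runs have two vertices, one vertex from each odd run suffices for the middle
    -- pair.
    exact hl.false_of_two_two_two hO₁ hxe (y := q) (y' := q') (fun h => by subst h; omega) hze
      (by omega) (by omega)

/-- The case in which the odd positions form at least three intervals. -/
theorem classification_three_blocks (hl : Layout H pos) (hO₁ : ¬ H.HasPattern arcs222)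
    (hO₃ : ¬ H.HasPattern arcs211C1) (hO₄ : ¬ H.HasPattern arcs1C112) {e e' q q' s s' m : H.V}
    (he : pos e % 2 = 0 ∧ ∀ v, pos e ≤ pos v) (he' : pos e' % 2 = 0 ∧ ∀ v, pos v ≤ pos e')
    (hq : pos q % 2 = 1 ∧ ∀ v, pos v % 2 = 1 → pos q ≤ pos v)
    (hq' : pos q' % 2 = 1 ∧ ∀ v, pos v % 2 = 1 → pos v ≤ pos q')
    (hs : pos s % 2 = 0 ∧ pos q < pos s ∧ ∀ v, pos v % 2 = 0 → pos q < pos v → pos s ≤ pos v)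
    (hs' : pos s' % 2 = 0 ∧ pos s' < pos q' ∧
      ∀ v, pos v % 2 = 0 → pos v < pos q' → pos v ≤ pos s')
    (hm : pos m % 2 = 1 ∧ pos s ≤ pos m ∧ pos m ≤ pos s') :
    ∃ k₁ k₂ k₃ k₄ : ℕ+, H.IsIso (delta7 I (L k₁) (L k₂) I (L k₃) (L k₄) I) := by
  have hqe := he.2 q
  have hqe' := he'.2 q'
  -- Two odd vertices between `s` and `s'` would have `e`, `s` before them and `s'`, `e'` after
  -- them. So `m` is the only one, and there are exactly three odd runs.
  have hmid : ∀ v, pos v % 2 = 1 → pos s ≤ pos v → pos v ≤ pos s' → v = m := fun v h1 h2 h3 => by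
    by_contra hvm
    exact hl.false_of_two_two_two hO₁ (x := e) (x' := s) (y := v) (y' := m) (z := s') (z' := e')
      (fun h => by subst h; omega) hvm (fun h => by subst h; omega) (by omega) (by omega)
  have key : ∀ v, (pos v < pos q → pos v % 2 = 0) ∧
      (pos q ≤ pos v → pos v < pos s → pos v % 2 = 1) ∧
      (pos s ≤ pos v → pos v < pos m → pos v % 2 = 0) ∧
      (pos m ≤ pos v → pos v < pos m + 1 → pos v % 2 = 1) ∧
      (pos m + 1 ≤ pos v → pos v < pos s' + 1 → pos v % 2 = 0) ∧
      (pos s' + 1 ≤ pos v → pos v < pos q' + 1 → pos v % 2 = 1) ∧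
      (pos q' + 1 ≤ pos v → pos v % 2 = 0) := fun v => by
    have h1 := hq.2 v
    have h2 := hq'.2 v
    have h3 := hs.2.2 v
    have h4 := hs'.2.2 v
    have h5 : pos v % 2 = 1 → pos s ≤ pos v → pos v ≤ pos s' → pos v = pos m :=
      fun h1 h2 h3 => by rw [hmid v h1 h2 h3]
    omega
  have hA : H.IsoOn (fun v => pos v < pos q) I := by
    refine (isoOn_I_or_exists_ne (v := e) (by omega)).resolve_right ?_
    rintro ⟨x, hx, hxe⟩
    have := (key x).1 hx
    exact hl.false_of_two_two_two hO₁ hxe (y := q) (y' := m) (z := s') (z' := e')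
      (fun h => by subst h; omega) (fun h => by subst h; omega) (by omega) (by omega)
  have hG : H.IsoOn (fun v => pos q' + 1 ≤ pos v) I := by
    refine (isoOn_I_or_exists_ne (v := e') (by omega)).resolve_right ?_
    rintro ⟨z, hz, hze⟩
    have := (key z).2.2.2.2.2.2 hz
    exact hl.false_of_two_two_two hO₁ (x := e) (x' := s) (y := m) (y' := q') (z := z) (z' := e')
      (fun h => by subst h; omega) (fun h => by subst h; omega) hze (by omega) (by omega)
  have hD : H.IsoOn (fun v => pos m ≤ pos v ∧ pos v < pos m + 1) I :=
    isoOn_I (v := m) (by omega) fun v hv =>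
      hmid v ((key v).2.2.2.1 hv.1 hv.2) (by omega) (by omega)
  obtain ⟨k₂, hC⟩ := hl.exists_isoOn_L_of_even (P := fun v => pos s ≤ pos v ∧ pos v < pos m)
    ⟨s, by omega⟩ fun v hv => (key v).2.2.1 hv.1 hv.2
  obtain ⟨k₃, hE⟩ := hl.exists_isoOn_L_of_even
    (P := fun v => pos m + 1 ≤ pos v ∧ pos v < pos s' + 1)
    ⟨s', by omega⟩ fun v hv => (key v).2.2.2.2.1 hv.1 hv.2
  -- A cyclic triangle in either outer odd run, together with `m` and even vertices on both sides of
  -- it, gives one of the mirror patterns Δ(I,C₃,I,I,L₂) and Δ(L₂,I,I,C₃,I).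
  rcases exists_isoOn_L_or_triangle (P := fun v => pos q ≤ pos v ∧ pos v < pos s)
    ⟨q, by omega⟩ with ⟨k₁, hB⟩ | ⟨a₀, a₁, a₂, ha, a01, a12, a20⟩
  · rcases exists_isoOn_L_or_triangle (P := fun v => pos s' + 1 ≤ pos v ∧ pos v < pos q' + 1)
      ⟨q', by omega⟩ with ⟨k₄, hF⟩ | ⟨b₀, b₁, b₂, hb, b01, b12, b20⟩
    · exact ⟨k₁, k₂, k₃, k₄, hl.isIso_delta7 (by omega) key hA hB hC hD hE hF hG⟩
    · exfalso
      have := (key b₀).2.2.2.2.2.1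
      have := (key b₁).2.2.2.2.2.1
      have := (key b₂).2.2.2.2.2.1
      exact hO₃ (hl.hasPattern_211C1 (x₀ := s) (x₁ := e) (a := m) (y := s') (z := e')
        (by omega) (by omega) b01 b12 b20)
  · exfalso
    have := (key a₀).2.1
    have := (key a₁).2.1
    have := (key a₂).2.1
    exact hO₄ (hl.hasPattern_1C112 (x := e) (y := s) (b := m) (z₀ := e') (z₁ := s')
      (by omega) (by omega) a01 a12 a20)

end Layout

end Tournament

theorem mainTheorem1 (D H : Tournament)
    (hD : D ∈ Tournament.classD) (hD3 : D.Contains (Tournament.D 3))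
    (hH : Tournament.IsHeroFor D H) :
    H.IsIso Tournament.I ∨
    (∃ H₁ H₂ : Tournament, Tournament.IsHeroFor D H₁ ∧ Tournament.IsHeroFor D H₂ ∧
      H.IsIso (Tournament.arrow H₁ H₂)) ∨
    (∃ (k : ℕ+) (H' : Tournament), Tournament.IsHeroFor D H' ∧
      (H.IsIso (Tournament.delta3 Tournament.I (Tournament.L k) H') ∨
        H.IsIso (Tournament.delta3 Tournament.I H' (Tournament.L k)))) ∨
    (∃ k₁ k₂ k₃ : ℕ+,
      H.IsIso (Tournament.delta5 (Tournament.L k₁) Tournament.I (Tournament.L k₂)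
          (Tournament.L k₃) Tournament.I) ∨
        H.IsIso (Tournament.delta5 Tournament.I (Tournament.L k₁) (Tournament.L k₂)
          Tournament.I (Tournament.L k₃))) ∨
    (∃ (k₁ k₂ : ℕ+) (H' : Tournament), Tournament.IsHeroFor D H' ∧
      (H.IsIso (Tournament.delta5 Tournament.I H' (Tournament.L k₁) (Tournament.L k₂)
          Tournament.I) ∨
        H.IsIso (Tournament.delta5 Tournament.I (Tournament.L k₁) (Tournament.L k₂) H'
          Tournament.I))) ∨
    (∃ k₁ k₂ k₃ k₄ : ℕ+,
      H.IsIso (Tournament.delta7 Tournament.I (Tournament.L k₁) (Tournament.L k₂)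
        Tournament.I (Tournament.L k₃) (Tournament.L k₄) Tournament.I)) := by
  obtain ⟨k, hk⟩ := hH.exists_layers_contains hD3
  rcases Tournament.exists_layout k hk with h | ⟨pos, hl, hne⟩
  · exact Or.inl h
  right
  -- Strong connectivity, stated through cuts; a cut without a backward edge is the decomposition H₁
  -- ⇒ H₂.
  by_cases hs : ∀ P : H.V → Prop, (∃ v, P v) → (∃ v, ¬ P v) → ∃ u v, P u ∧ ¬ P v ∧ H.Adj v u
  swap
  · push Not at hs
    obtain ⟨P, hP, hQ, h⟩ := hs
    refine Or.inl ⟨_, _, hH.mono (Tournament.contains_induce hP),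
      hH.mono (Tournament.contains_induce hQ), Tournament.isIso_arrow hP hQ fun u v hu hv => ?_⟩
    exact (H.total u v fun e => hv (e ▸ hu)).resolve_right (h u v hu hv)
  right
  have hO₁ := hH.not_hasPattern hD3 Tournament.descartesFree_arcs222
  have hO₂ := hH.not_hasPattern hD3 Tournament.descartesFree_arcs1C1C1
  have hO₃ := hH.not_hasPattern hD3 Tournament.descartesFree_arcs211C1
  have hO₄ := hH.not_hasPattern hD3 Tournament.descartesFree_arcs1C112
  obtain ⟨⟨e, he⟩, ⟨e', he'⟩, hodd⟩ := hl.exists_extremal hne hs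
  obtain ⟨q, hq⟩ := Tournament.exists_min_of_exists pos hodd
  obtain ⟨q', hq'⟩ := Tournament.exists_max_of_exists pos hodd
  by_cases hmid : ∀ v, pos q < pos v → pos v < pos q' → pos v % 2 = 1
  · exact Or.inl (hl.classification_one_block hH hO₁ he he' hq hq' hmid)
  right
  push Not at hmid
  obtain ⟨t, ht, ht', ht0⟩ := hmid
  have ht0 : pos t % 2 = 0 := by omega
  -- The even vertex `t` separates odd runs; `s` ends the first odd run and `s'` precedes the last,
  -- so an odd position between them decides between two runs and three.
  obtain ⟨s, ⟨hs0, hqs⟩, hs⟩ := Tournament.exists_min_of_exists pos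
    (P := fun v => pos v % 2 = 0 ∧ pos q < pos v) ⟨t, ht0, ht⟩
  obtain ⟨s', ⟨hs0', hqs'⟩, hs'⟩ := Tournament.exists_max_of_exists pos
    (P := fun v => pos v % 2 = 0 ∧ pos v < pos q') ⟨t, ht0, ht'⟩
  have hS : pos s % 2 = 0 ∧ pos q < pos s ∧ ∀ v, pos v % 2 = 0 → pos q < pos v → pos s ≤ pos v :=
    ⟨hs0, hqs, fun v h h' => hs v ⟨h, h'⟩⟩
  have hS' : pos s' % 2 = 0 ∧ pos s' < pos q' ∧
      ∀ v, pos v % 2 = 0 → pos v < pos q' → pos v ≤ pos s' :=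
    ⟨hs0', hqs', fun v h h' => hs' v ⟨h, h'⟩⟩
  by_cases hm : ∀ v, pos s ≤ pos v → pos v ≤ pos s' → pos v % 2 = 0
  · rcases hl.classification_two_blocks hH hO₁ hO₂ hO₃ hO₄ he he' hq hq' hS hS'
      ((hs t ⟨ht0, ht⟩).trans (hs' t ⟨ht0, ht'⟩)) hm with h | h
    · exact Or.inl h
    · exact Or.inr (Or.inl h)
  · push Not at hm
    obtain ⟨m, h1, h2, h3⟩ := hm
    exact Or.inr (Or.inr (hl.classification_three_blocks hO₁ hO₃ hO₄ he he' hq hq' hS hS'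
      ⟨by omega, h1, h2⟩))
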